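/- Let $G$ be the additive group of $\mathbb{Z}$ or of $\mathbb{F}_p$ ($p$ prime), and let $\Gamma=(V,E,G)$ be a simple gain graph: $V$ is a finite set and $E$ is a finite set of classes $[i,j,g]$ of triples $(i,j,g)\in V\times V\times G$ with $i\neq j$, modulo $(i,j,g)\sim(j,i,-g)$. Put $K=\mathbb{Q}$ if $G=\mathbb{Z}$ and $K=\mathbb{F}_p$ if $G=\mathbb{F}_p$. Let $q\in\mathbb{C}^\times$ be an element that is not a root of unity if $G=\mathbb{Z}$, and a primitive $p$-th root of unity if $G=\mathbb{F}_p$. Let $$\mathbf{c}\mathcal{A}(\Gamma)=\{\{z=0\}\}\cup\{\{x_i-x_j=gz\}\mid [i,j,g]\in E\}$$ in $K^{V}\times K$ be the cone over the affinographic arrangement $\mathcal{A}(\Gamma)=\{\{x_i-x_j=g\}\mid[i,j,g]\in E\}$ in $K^V$, and let $$\mathcal{B}(\Gamma)=\{\{x_i=0\}\mid i\in V\}\cup\{\{x_i-q^gx_j=0\}\mid[i,j,g]\in E\}$$ in $\mathbb{C}^V$ be the bias arrangement. For an edge $e=[i,j,g]$ let $\Gamma\setminus e$ be $\Gamma$ with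 $e$ removed, and let $\Gamma/e$ be the gain graph on $V\setminus\{i\}$ whose edges are the edges $[u,v,h]\in E$ with $u,v\neq i$ and the edges $[k,j,h+g]$ with $[k,i,h]\in E$, $k\neq j$. A central arrangement with ambient coordinate ring $S$ is free with exponents the multiset $\exp=\{d_1,\dots,d_n\}$ if its module of logarithmic derivations $D$ (the derivations $\theta$ of $S$ with $\theta(\alpha_H)\in\alpha_HS$ for every hyperplane $H=\ker\alpha_H$) is isomorphic to $\bigoplus_i S(-d_i)$ as a graded $S$-module. Let $\mathcal{C}$ stand for $\mathbf{c}\mathcal{A}$ or for $\mathcal{B}$. The arrangement $\mathcal{C}(\Gamma)$ is *inductively free along edges* if it is so by finitely many applications of the following rules: (i) it is if $E=\varnothing$; (ii) it is if there is $e\in E$ such that $\mathcal{C}(\Gamma\setminus e)$ and $\mathcal{C}(\Gamma/e)$ are inductively free along edges and $\exp(\mathcal{C}(\Gamma/e))\subseteq\exp(\mathcal{C}(\Gamma\setminus e))$ as multisets (with both arrangements free, so that the exponents are defined). **Theorem.** $\mathbf{c}\mathcal{A}(\Gamma)$ is inductively free along edges if and only if $\mathcal{B}(\Gamma)$ is inductively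 free along edges. -/

import Mathlib

universe u v

/-! ### Simple gain graphs -/

/-- A directed edge `(i, j, g)` with `i ≠ j`, with gain `g` in the additively written group `G`. -/
@[ext]
structure GainDart (V : Type u) (G : Type v) where
  fst : V
  snd : V
  gain : G
  ne : fst ≠ snd

/-- The reversal `(j, i, -g)` of `(i, j, g)`. -/
def GainDart.rev {V : Type u} {G : Type v} [AddGroup G] (a : GainDart V G) : GainDart V G :=
  ⟨a.snd, a.fst, -a.gain, a.ne.symm⟩

theorem GainDart.rev_rev {V : Type u} {G : Type v} [AddGroup G] (a : GainDart V G) :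
    a.rev.rev = a := by
  simp [GainDart.rev]

/-- The equivalence relation generated by `(i, j, g) ∼ (j, i, -g)`; reversal being an involution,
two directed edges are equivalent iff they are equal or reverse to each other. -/
def gainSetoid (V : Type u) (G : Type v) [AddGroup G] : Setoid (GainDart V G) where
  r a b := a = b ∨ a = b.rev
  iseqv :=
    { refl := fun _ => Or.inl rfl
      symm := by
        rintro a b (rfl | rfl)
        · exact Or.inl rfl
        · exact Or.inr (GainDart.rev_rev b).symm
      trans := by
        rintro a b c (rfl | rfl) (rfl | rfl)
        · exact Or.inl rfl
        · exact Or.inr rfl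
        · exact Or.inr rfl
        · exact Or.inl (GainDart.rev_rev c) }

/-- The set of possible edges `{(i, j, g) | i ≠ j} / ∼`. -/
def GainEdge (V : Type u) (G : Type v) [AddGroup G] : Type (max u v) :=
  Quotient (gainSetoid V G)

/-- The class `[i, j, g]`. -/
def GainEdge.mk {V : Type u} {G : Type v} [AddGroup G] (i j : V) (g : G) (h : i ≠ j) :
    GainEdge V G :=
  Quotient.mk (gainSetoid V G) ⟨i, j, g, h⟩

theorem GainEdge.mk_eq_mk_iff {V : Type u} {G : Type v} [AddGroup G] {i j k l : V} {g h : G}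
    {hij : i ≠ j} {hkl : k ≠ l} :
    GainEdge.mk i j g hij = GainEdge.mk k l h hkl ↔
      (i = k ∧ j = l ∧ g = h) ∨ (i = l ∧ j = k ∧ g = -h) := by
  constructor
  · intro H
    rcases (Quotient.exact H : (_ : GainDart V G) = _ ∨ _ = _) with H | H
    · exact Or.inl (by simpa using H)
    · exact Or.inr (by simpa [GainDart.rev] using H)
  · rintro (⟨rfl, rfl, rfl⟩ | ⟨rfl, rfl, rfl⟩)
    · rfl
    · exact Quotient.sound (Or.inr (by simp [GainDart.rev]))

/-- A simple gain graph with vertex set `V` and gain group `G` (`V` is required to be finite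
wherever a gain graph is used). -/
structure SimpleGainGraph (V : Type u) (G : Type v) [AddGroup G] where
  edges : Set (GainEdge V G)
  finite_edges : edges.Finite

namespace SimpleGainGraph

variable {V : Type u} {G : Type v} [AddGroup G]

/-- The deletion `Γ \ e`. -/
def delete (Γ : SimpleGainGraph V G) (e : GainEdge V G) : SimpleGainGraph V G where
  edges := Γ.edges \ {e}
  finite_edges := Γ.finite_edges.sdiff

/-- The edge set of the contraction `Γ / (i, j, g)`, on the vertex set `V \ {i}`: the edges
`[u, v, h]` of `Γ` with `u, v ≠ i`, and an edge `[k, j, h + g]` for each edge `[k, i, h]` of `Γ`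
with `k ≠ j` (an edge parallel to `[i, j, g]` would become a loop, and disappears). -/
def contractEdges (Γ : SimpleGainGraph V G) (i j : V) (g : G) (hij : i ≠ j) :
    Set (GainEdge {w : V // w ≠ i} G) :=
  {f | ∃ (u v : {w : V // w ≠ i}) (h : G) (huv : u ≠ v),
      GainEdge.mk (u : V) (v : V) h (fun H => huv (Subtype.ext H)) ∈ Γ.edges ∧
        f = GainEdge.mk u v h huv} ∪
  {f | ∃ (k : {w : V // w ≠ i}) (h : G) (hk : k ≠ ⟨j, hij.symm⟩),
      GainEdge.mk (k : V) i h k.2 ∈ Γ.edges ∧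
        f = GainEdge.mk k ⟨j, hij.symm⟩ (h + g) hk}

theorem finite_contractEdges (Γ : SimpleGainGraph V G) (i j : V) (g : G) (hij : i ≠ j) :
    (Γ.contractEdges i j g hij).Finite := by
  refine Set.Finite.union ?_ ?_
  · -- the vertex inclusion induces an injection on edges
    let D := GainDart {w : V // w ≠ i} G
    let F : D → GainEdge V G := fun a =>
      GainEdge.mk (a.fst : V) (a.snd : V) a.gain (fun H => a.ne (Subtype.ext H))
    let P : GainEdge V G → Set (GainEdge {w : V // w ≠ i} G) := fun e =>
      {f | ∃ a : D, F a = e ∧ f = GainEdge.mk a.fst a.snd a.gain a.ne}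
    have hP : ∀ e ∈ Γ.edges, (P e).Finite := by
      intro e _
      refine Set.Subsingleton.finite ?_
      rintro _ ⟨a, ha, rfl⟩ _ ⟨b, hb, rfl⟩
      rw [GainEdge.mk_eq_mk_iff]
      simpa [F, GainEdge.mk_eq_mk_iff, Subtype.ext_iff] using ha.trans hb.symm
    refine (Γ.finite_edges.biUnion hP).subset ?_
    rintro _ ⟨u, v, h, huv, hmem, rfl⟩
    exact Set.mem_biUnion hmem ⟨⟨u, v, h, huv⟩, rfl, rfl⟩
  · let D := {k : {w : V // w ≠ i} // k ≠ ⟨j, hij.symm⟩} × G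
    let F : D → GainEdge V G := fun a => GainEdge.mk (a.1.1 : V) i a.2 a.1.1.2
    have hF : Function.Injective F := by
      rintro ⟨⟨⟨k, hk⟩, hkj⟩, h⟩ ⟨⟨⟨k', hk'⟩, hkj'⟩, h'⟩ H
      rcases GainEdge.mk_eq_mk_iff.1 H with ⟨h1, _, h3⟩ | ⟨h1, _, _⟩
      · simp only at h1 h3
        subst h1 h3
        rfl
      · exact absurd h1 hk
    refine ((Γ.finite_edges.preimage hF.injOn).image
      (fun a : D => GainEdge.mk a.1.1 ⟨j, hij.symm⟩ (a.2 + g) a.1.2)).subset ?_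
    rintro _ ⟨k, h, hk, hmem, rfl⟩
    exact ⟨(⟨k, hk⟩, h), hmem, rfl⟩

/-- The contraction `Γ / (i, j, g)`. -/
def contract (Γ : SimpleGainGraph V G) (i j : V) (g : G) (hij : i ≠ j) :
    SimpleGainGraph {w : V // w ≠ i} G where
  edges := Γ.contractEdges i j g hij
  finite_edges := Γ.finite_contractEdges i j g hij

end SimpleGainGraph

/-! ### Central arrangements: logarithmic derivations, freeness and exponents

A central arrangement in `K^ι` is given as a set of linear hyperplanes of `ι → K`, and an affine
arrangement as a set of affine hyperplanes (as point sets). -/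

/-- A linear form on `K^ι`, as a polynomial of degree one in the coordinates. -/
noncomputable def linearFormPoly {K : Type*} [Field K] {ι : Type*} [Fintype ι]
    (α : (ι → K) →ₗ[K] K) : MvPolynomial ι K := by
  classical
  exact ∑ i, MvPolynomial.C (α (Pi.single i 1)) * MvPolynomial.X i

/-- The derivations `θ` of the `K`-algebra `S` with `θ(α) ∈ α S` for all `α ∈ F`. -/
def logDerOf (K : Type*) {S : Type*} [CommRing K] [CommRing S] [Algebra K S] (F : Set S) :
    Submodule S (Derivation K S S) where
  carrier := {θ | ∀ α ∈ F, α ∣ θ α}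
  add_mem' := by
    intro θ η hθ hη α hα
    rw [Derivation.add_apply]
    exact dvd_add (hθ α hα) (hη α hα)
  zero_mem' := by
    intro α _
    rw [Derivation.zero_apply]
    exact dvd_zero _
  smul_mem' := by
    intro f θ hθ α hα
    rw [Derivation.smul_apply, smul_eq_mul]
    exact Dvd.dvd.mul_left (hθ α hα) f

/-- The module `D(𝒜)` of logarithmic derivations: the derivations `θ` of `S = K[x_i | i ∈ ι]` with
`θ(α_H) ∈ α_H S` for all `H ∈ 𝒜`, for a defining linear form `α_H` of `H` (the condition does not
depend on the choice of `α_H`, which is unique up to a nonzero scalar). -/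
noncomputable def logDer {K : Type*} [Field K] {ι : Type*} [Fintype ι]
    (𝒜 : Set (Submodule K (ι → K))) :
    Submodule (MvPolynomial ι K) (Derivation K (MvPolynomial ι K) (MvPolynomial ι K)) :=
  logDerOf K {f | ∃ α : (ι → K) →ₗ[K] K, LinearMap.ker α ∈ 𝒜 ∧ f = linearFormPoly α}

/-- The family `θ` is a basis of the submodule `N` of `M`. -/
def IsBasisOfSubmodule {S M ι : Type*} [CommRing S] [AddCommGroup M] [Module S M]
    (N : Submodule S M) (θ : ι → M) : Prop :=
  LinearIndependent S θ ∧ Submodule.span S (Set.range θ) = N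

/-- `𝒜` is free and `d` is its multiset of exponents: `D(𝒜) ≅ ⨁ S(-d_i)` as graded modules, i.e.
`D(𝒜)` has an `S`-basis of derivations homogeneous of (polynomial) degrees `d_i`. -/
def FreeWithExponents {K : Type*} [Field K] {ι : Type*} [Fintype ι]
    (𝒜 : Set (Submodule K (ι → K))) (d : Multiset ℕ) : Prop :=
  ∃ (θ : ι → Derivation K (MvPolynomial ι K) (MvPolynomial ι K)) (deg : ι → ℕ),
    IsBasisOfSubmodule (logDer 𝒜) θ ∧
    (∀ k i, (θ k (MvPolynomial.X i)).IsHomogeneous (deg k)) ∧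
    d = Finset.univ.val.map deg

/-- The cone over an affine arrangement in `K^ι`: the arrangement in `K^ι × K` (the coordinate
`none` being the additional coordinate `z`) that consists of the hyperplane at infinity `z = 0` and
of the homogenizations `α(x) = c z` of the hyperplanes `α(x) = c` of the arrangement. -/
def cone {K : Type*} [Field K] {ι : Type*} (𝒜 : Set (Set (ι → K))) :
    Set (Submodule K (Option ι → K)) :=
  {LinearMap.ker (LinearMap.proj none : (Option ι → K) →ₗ[K] K)} ∪
  {H | ∃ (α : (ι → K) →ₗ[K] K) (c : K), α ≠ 0 ∧ {x | α x = c} ∈ 𝒜 ∧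
    H = LinearMap.ker (α ∘ₗ LinearMap.funLeft K K some -
      c • (LinearMap.proj none : (Option ι → K) →ₗ[K] K))}

/-! ### Affinographic and bias arrangements -/

/-- The arrangement of the hyperplanes `x_i - x_j = κ(g)`, for the edges `[i, j, g]` of `Γ`, in
`K^V`. Here `κ` is the inclusion of the gain group in `K`. -/
def affinographic {K : Type*} [Field K] {V : Type u} {G : Type v} [AddGroup G] (κ : G → K)
    (Γ : SimpleGainGraph V G) : Set (Set (V → K)) :=
  {H | ∃ (i j : V) (g : G) (hij : i ≠ j), GainEdge.mk i j g hij ∈ Γ.edges ∧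
    H = {x | x i - x j = κ g}}

/-- The arrangement of the hyperplanes `x_i = 0`, for all vertices `i`, and `x_i - χ(g) x_j = 0`,
for the edges `[i, j, g]` of `Γ`, in `ℂ^V`. Here `χ` is the map `g ↦ q ^ g`. -/
def bias {V : Type u} {G : Type v} [AddGroup G] (χ : G → ℂ)
    (Γ : SimpleGainGraph V G) : Set (Submodule ℂ (V → ℂ)) :=
  {H | ∃ i : V, H = LinearMap.ker (LinearMap.proj i : (V → ℂ) →ₗ[ℂ] ℂ)} ∪
  {H | ∃ (i j : V) (g : G) (hij : i ≠ j), GainEdge.mk i j g hij ∈ Γ.edges ∧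
    H = LinearMap.ker ((LinearMap.proj i : (V → ℂ) →ₗ[ℂ] ℂ) -
      χ g • (LinearMap.proj j : (V → ℂ) →ₗ[ℂ] ℂ))}

/-! ### Inductive freeness along edges -/

/-- The cone over the affinographic arrangement of `Γ` is inductively free along edges. -/
inductive ConeInductivelyFreeAlongEdges {K : Type*} [Field K] {G : Type v} [AddGroup G]
    (κ : G → K) : ∀ {V : Type u} [Fintype V] [DecidableEq V], SimpleGainGraph V G → Prop
  | of_isEmpty {V : Type u} [Fintype V] [DecidableEq V] (Γ : SimpleGainGraph V G)
      (h : Γ.edges = ∅) : ConeInductivelyFreeAlongEdges κ Γ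
  | of_edge {V : Type u} [Fintype V] [DecidableEq V] (Γ : SimpleGainGraph V G)
      (i j : V) (g : G) (hij : i ≠ j) (he : GainEdge.mk i j g hij ∈ Γ.edges)
      (hdel : ConeInductivelyFreeAlongEdges κ (Γ.delete (GainEdge.mk i j g hij)))
      (hcon : ConeInductivelyFreeAlongEdges κ (Γ.contract i j g hij))
      (d' d'' : Multiset ℕ)
      (hd' : FreeWithExponents
        (cone (affinographic κ (Γ.delete (GainEdge.mk i j g hij)))) d')
      (hd'' : FreeWithExponents (cone (affinographic κ (Γ.contract i j g hij))) d'')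
      (hle : d'' ≤ d') : ConeInductivelyFreeAlongEdges κ Γ

/-- The bias arrangement of `Γ` is inductively free along edges. -/
inductive BiasInductivelyFreeAlongEdges {G : Type v} [AddGroup G]
    (χ : G → ℂ) : ∀ {V : Type u} [Fintype V] [DecidableEq V], SimpleGainGraph V G → Prop
  | of_isEmpty {V : Type u} [Fintype V] [DecidableEq V] (Γ : SimpleGainGraph V G)
      (h : Γ.edges = ∅) : BiasInductivelyFreeAlongEdges χ Γ
  | of_edge {V : Type u} [Fintype V] [DecidableEq V] (Γ : SimpleGainGraph V G)
      (i j : V) (g : G) (hij : i ≠ j) (he : GainEdge.mk i j g hij ∈ Γ.edges)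
      (hdel : BiasInductivelyFreeAlongEdges χ (Γ.delete (GainEdge.mk i j g hij)))
      (hcon : BiasInductivelyFreeAlongEdges χ (Γ.contract i j g hij))
      (d' d'' : Multiset ℕ)
      (hd' : FreeWithExponents (bias χ (Γ.delete (GainEdge.mk i j g hij))) d')
      (hd'' : FreeWithExponents (bias χ (Γ.contract i j g hij)) d'')
      (hle : d'' ≤ d') : BiasInductivelyFreeAlongEdges χ Γ

open MvPolynomial

/-! ### Homogeneous polynomials and linear forms -/

section LinearForms

variable {K : Type*} [Field K] {ι : Type*}

/-! Both notions of inductive freeness are equivalent to one condition that mentions no arrangement,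
`∃ d, InductiveExponents Γ d`. The point is that the recursion itself determines the exponents:
whenever `InductiveExponents Γ d` holds, the cone is free with exponents `1, d` and the bias
arrangement is free with every member of `d` increased by one. Inclusion of exponents therefore
means the same inclusion of multisets on both sides.

The exponents come from the addition theorem `HasHomogeneousBasis.addition`. It applies because
restricting either arrangement to the hyperplane of an edge gives the arrangement of the contraction
(`IsContractionMap`), and because `d` sums to the number of edges, which supplies the required count
of hyperplanes. Conversely, exponents are unique (`HasHomogeneousBasis.unique`), so those in a given
inductive freeness derivation are the predicted ones. As `d` has one member per vertex, an inclusion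
between contraction and deletion leaves out exactly one exponent.

The addition theorem is proved without determinants. On the hyperplane `ker α`, each `θ(α)`, for `θ`
logarithmic along the deletion, is divisible by a fixed polynomial `b` of degree `a`. Counting
independent derivations of degree at most `a` shows that some basis member `θ_k` of degree `a`
restricts to a nonzero scalar times `b`. Subtracting multiples of `θ_k` from the other members and
multiplying `θ_k` by `α` gives the new basis. -/

theorem homogeneousComponent_mul_of_isHomogeneous {g : MvPolynomial ι K} {e : ℕ}
    (hg : g.IsHomogeneous e) (f : MvPolynomial ι K) (n : ℕ) :
    homogeneousComponent n (f * g) =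
      if e ≤ n then homogeneousComponent (n - e) f * g else 0 := by
  classical
  let _ : GradedAlgebra (homogeneousSubmodule ι K) := MvPolynomial.gradedAlgebra
  have := DirectSum.coe_decompose_mul_of_right_mem (homogeneousSubmodule ι K) (a := f) n
    ((mem_homogeneousSubmodule e g).2 hg)
  have key (p : MvPolynomial ι K) (m : ℕ) :
      (DirectSum.decompose (homogeneousSubmodule ι K) p m : MvPolynomial ι K) =
        homogeneousComponent m p := decomposition.decompose'_apply p m
  simpa only [key] using this

theorem isHomogeneous_ite_homogeneousComponent (f : MvPolynomial ι K) {a n : ℕ} :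
    (if a ≤ n then homogeneousComponent (n - a) f else 0).IsHomogeneous (n - a) := by
  split_ifs
  · exact homogeneousComponent_isHomogeneous _ _
  · exact isHomogeneous_zero _ _ _

/-- Total degrees add over a domain, so one factor of a linear form is constant; irreducible
elements are prime in a UFD. -/
theorem prime_of_isHomogeneous_one {f : MvPolynomial ι K} (hf : f.IsHomogeneous 1) (h0 : f ≠ 0) :
    Prime f := by
  have unit : ∀ g : MvPolynomial ι K, g ≠ 0 → g.totalDegree = 0 → IsUnit g := by
    intro g hg h
    rw [totalDegree_eq_zero_iff_eq_C] at h
    rw [h]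
    refine (IsUnit.mk0 _ fun h' => hg ?_).map C
    rw [h, h', map_zero]
  rw [← UniqueFactorizationMonoid.irreducible_iff_prime, irreducible_iff]
  constructor
  · intro hu
    have h1 := hf.totalDegree h0
    obtain ⟨r, _, hr⟩ := MvPolynomial.isUnit_iff_eq_C_of_isReduced.1 hu
    rw [hr, totalDegree_C] at h1
    exact zero_ne_one h1
  · rintro a b rfl
    have ha := left_ne_zero_of_mul h0
    have hb := right_ne_zero_of_mul h0
    have h1 := hf.totalDegree h0
    rw [totalDegree_mul_of_isDomain ha hb] at h1
    rcases Nat.add_eq_one_iff.1 h1 with h | h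
    · exact Or.inl (unit a ha h.1)
    · exact Or.inr (unit b hb h.2)

variable [Fintype ι]

theorem linearFormPoly_eq_sum [DecidableEq ι] (α : (ι → K) →ₗ[K] K) :
    linearFormPoly α = ∑ i, C (α (Pi.single i 1)) * X i := by
  unfold linearFormPoly
  congr!

theorem eval_linearFormPoly (α : (ι → K) →ₗ[K] K) (x : ι → K) :
    eval x (linearFormPoly α) = α x := by
  classical
  rw [linearFormPoly_eq_sum, map_sum]
  conv_rhs => rw [pi_eq_sum_univ' x, map_sum]
  refine Finset.sum_congr rfl fun i _ => ?_
  rw [map_smul]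
  simp only [map_mul, eval_C, eval_X, smul_eq_mul]
  rw [mul_comm]

theorem linearFormPoly_sub (α β : (ι → K) →ₗ[K] K) :
    linearFormPoly (α - β) = linearFormPoly α - linearFormPoly β := by
  classical
  simp [linearFormPoly_eq_sum, sub_mul, Finset.sum_sub_distrib]

theorem linearFormPoly_smul (c : K) (α : (ι → K) →ₗ[K] K) :
    linearFormPoly (c • α) = C c * linearFormPoly α := by
  classical
  simp [linearFormPoly_eq_sum, Finset.mul_sum, mul_assoc]

theorem linearFormPoly_proj (i : ι) :
    linearFormPoly (LinearMap.proj i : (ι → K) →ₗ[K] K) = X i := by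
  classical
  rw [linearFormPoly_eq_sum, Finset.sum_eq_single i]
  · simp
  · intro j _ hj
    simp [hj.symm]
  · simp

theorem linearFormPoly_isHomogeneous (α : (ι → K) →ₗ[K] K) :
    (linearFormPoly α).IsHomogeneous 1 := by
  classical
  rw [linearFormPoly_eq_sum]
  exact IsHomogeneous.sum _ _ _ fun i _ => isHomogeneous_C_mul_X _ _

theorem linearFormPoly_ne_zero {α : (ι → K) →ₗ[K] K} (hα : α ≠ 0) : linearFormPoly α ≠ 0 := by
  intro h
  refine hα (LinearMap.ext fun x => ?_)
  rw [← eval_linearFormPoly, h, map_zero, LinearMap.zero_apply]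

theorem linearFormPoly_prime {α : (ι → K) →ₗ[K] K} (hα : α ≠ 0) : Prime (linearFormPoly α) :=
  prime_of_isHomogeneous_one (linearFormPoly_isHomogeneous α) (linearFormPoly_ne_zero hα)

theorem exists_eq_smul_of_ker_le {E : Type*} [AddCommGroup E] [Module K E] {α β : E →ₗ[K] K}
    (h : LinearMap.ker α ≤ LinearMap.ker β) : ∃ c : K, β = c • α := by
  have := mem_span_of_iInf_ker_le_ker (ι := Unit) (L := fun _ => α) (K := β) (by simpa using h)
  rw [Set.range_const, Submodule.mem_span_singleton] at this
  obtain ⟨c, hc⟩ := this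
  exact ⟨c, hc.symm⟩

theorem exists_eq_smul_of_linearFormPoly_dvd {α β : (ι → K) →ₗ[K] K}
    (h : linearFormPoly α ∣ linearFormPoly β) : ∃ c : K, β = c • α := by
  apply exists_eq_smul_of_ker_le
  intro x hx
  rw [LinearMap.mem_ker] at hx ⊢
  obtain ⟨f, hf⟩ := h
  rw [← eval_linearFormPoly, hf, map_mul, eval_linearFormPoly, hx, zero_mul]

end LinearForms

/-! ### Linear substitutions in polynomials -/

section LinearSubstitution

variable {K : Type*} [Field K] {ι ι' : Type*} [Fintype ι']

/-- Substitution of a linear map in polynomials. -/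
noncomputable def substLinear (L : (ι' → K) →ₗ[K] (ι → K)) :
    MvPolynomial ι K →ₐ[K] MvPolynomial ι' K :=
  aeval fun i => linearFormPoly (LinearMap.proj i ∘ₗ L)

theorem substLinear_X (L : (ι' → K) →ₗ[K] (ι → K)) (i : ι) :
    substLinear L (X i) = linearFormPoly (LinearMap.proj i ∘ₗ L) :=
  aeval_X _ _

theorem substLinear_linearFormPoly [Fintype ι] (L : (ι' → K) →ₗ[K] (ι → K))
    (α : (ι → K) →ₗ[K] K) : substLinear L (linearFormPoly α) = linearFormPoly (α ∘ₗ L) := by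
  classical
  rw [linearFormPoly_eq_sum α, map_sum]
  simp only [map_mul, substLinear_X, algHom_C, algebraMap_eq]
  simp only [linearFormPoly_eq_sum, Finset.mul_sum]
  rw [Finset.sum_comm]
  refine Finset.sum_congr rfl fun j _ => ?_
  simp only [← mul_assoc, ← C_mul, ← Finset.sum_mul, ← map_sum]
  congr 2
  simp only [LinearMap.comp_apply, LinearMap.proj_apply]
  conv_rhs => rw [pi_eq_sum_univ' (L (Pi.single j 1)), map_sum]
  refine Finset.sum_congr rfl fun i _ => ?_
  rw [map_smul, smul_eq_mul, mul_comm]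

theorem substLinear_isHomogeneous (L : (ι' → K) →ₗ[K] (ι → K))
    {f : MvPolynomial ι K} {n : ℕ} (hf : f.IsHomogeneous n) :
    (substLinear L f).IsHomogeneous n := by
  have := hf.aeval (fun i => linearFormPoly (LinearMap.proj i ∘ₗ L)) (n := 1)
    fun i => linearFormPoly_isHomogeneous _
  rwa [one_mul] at this

theorem substLinear_substLinear {ι'' : Type*} [Fintype ι''] (L : (ι' → K) →ₗ[K] (ι → K))
    (M : (ι'' → K) →ₗ[K] (ι' → K)) (f : MvPolynomial ι K) :
    substLinear M (substLinear L f) = substLinear (L ∘ₗ M) f := by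
  have : (substLinear M).comp (substLinear L) = substLinear (L ∘ₗ M) := by
    ext1 i
    rw [AlgHom.comp_apply, substLinear_X, substLinear_X, substLinear_linearFormPoly,
      LinearMap.comp_assoc]
  rw [← this, AlgHom.comp_apply]

end LinearSubstitution

/-! ### Homogeneous derivations -/

theorem Multiset.eq_of_countP_le_eq {s u : Multiset ℕ}
    (h : ∀ t, s.countP (· ≤ t) = u.countP (· ≤ t)) : s = u := by
  have step : ∀ (s : Multiset ℕ) (n : ℕ),
      s.countP (· ≤ n + 1) = s.countP (· ≤ n) + s.count (n + 1) := by
    intro s n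
    induction s using Multiset.induction with
    | empty => simp
    | cons a s ih =>
      simp only [Multiset.countP_cons, Multiset.count_cons, ih]
      split_ifs <;> omega
  have zero : ∀ s : Multiset ℕ, s.countP (· ≤ 0) = s.count 0 := by
    intro s
    induction s using Multiset.induction with
    | empty => simp
    | cons a s ih =>
      simp only [Multiset.countP_cons, Multiset.count_cons, ih]
      split_ifs <;> omega
  ext n
  cases n with
  | zero => rw [← zero, ← zero, h]
  | succ n =>
    have h1 := h (n + 1)
    rw [step, step, h n] at h1
    omega

section Derivations

variable {K : Type*} [Field K] {ι : Type*}

theorem derivation_apply_C_mul (θ : Derivation K (MvPolynomial ι K) (MvPolynomial ι K)) (a : K)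
    (f : MvPolynomial ι K) : θ (C a * f) = C a * θ f := by
  rw [C_mul', C_mul', Derivation.map_smul]

/-- All the coefficients of the derivation `θ` are homogeneous of degree `d`. -/
def HomogeneousDer (θ : Derivation K (MvPolynomial ι K) (MvPolynomial ι K)) (d : ℕ) : Prop :=
  ∀ i, (θ (X i)).IsHomogeneous d

theorem HomogeneousDer.smul {θ : Derivation K (MvPolynomial ι K) (MvPolynomial ι K)} {d n : ℕ}
    (hθ : HomogeneousDer θ d) {f : MvPolynomial ι K} (hf : f.IsHomogeneous n) :
    HomogeneousDer (f • θ) (n + d) := by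
  intro i
  rw [Derivation.smul_apply, smul_eq_mul]
  exact hf.mul (hθ i)

theorem HomogeneousDer.sub {θ η : Derivation K (MvPolynomial ι K) (MvPolynomial ι K)} {d : ℕ}
    (hθ : HomogeneousDer θ d) (hη : HomogeneousDer η d) : HomogeneousDer (θ - η) d := by
  intro i
  rw [Derivation.sub_apply]
  exact (hθ i).sub (hη i)

theorem HomogeneousDer.apply_linearFormPoly [Fintype ι]
    {θ : Derivation K (MvPolynomial ι K) (MvPolynomial ι K)} {d : ℕ} (hθ : HomogeneousDer θ d)
    (α : (ι → K) →ₗ[K] K) : (θ (linearFormPoly α)).IsHomogeneous d := by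
  classical
  rw [linearFormPoly_eq_sum, map_sum]
  refine IsHomogeneous.sum _ _ _ fun i _ => ?_
  rw [derivation_apply_C_mul]
  exact (hθ i).C_mul _

theorem derivation_sum_smul_apply {J : Type*} (s : Finset J) (f : J → MvPolynomial ι K)
    (η : J → Derivation K (MvPolynomial ι K) (MvPolynomial ι K)) (x : MvPolynomial ι K) :
    (∑ j ∈ s, f j • η j) x = ∑ j ∈ s, f j * η j x := by
  rw [← Derivation.coeFnAddMonoidHom_apply, map_sum, Finset.sum_apply]
  rfl

theorem derivation_sub_smul (f g : MvPolynomial ι K)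
    (θ : Derivation K (MvPolynomial ι K) (MvPolynomial ι K)) :
    (f - g) • θ = f • θ - g • θ :=
  sub_smul f g θ

variable {J : Type*} [Fintype J]

/-- Taking degree `d` parts of the combination replaces each coefficient by its component of degree
`d - e j` without changing the sum, so independence identifies the two. The `if` guards the
truncated subtraction: members of degree above `d` get coefficient zero. -/
theorem HomogeneousDer.coefficient_eq
    {η : J → Derivation K (MvPolynomial ι K) (MvPolynomial ι K)} {e : J → ℕ}
    (hη : ∀ j, HomogeneousDer (η j) (e j)) (hli : LinearIndependent (MvPolynomial ι K) η)
    {d : ℕ} {f : J → MvPolynomial ι K} (hθ : HomogeneousDer (∑ j, f j • η j) d) (j : J) :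
    f j = if e j ≤ d then homogeneousComponent (d - e j) (f j) else 0 := by
  have h : ∑ j, (f j - if e j ≤ d then homogeneousComponent (d - e j) (f j) else 0) • η j = 0 := by
    refine derivation_ext fun i => ?_
    have h1 := homogeneousComponent_of_mem (m := d) ((mem_homogeneousSubmodule d _).2 (hθ i))
    rw [if_pos rfl, derivation_sum_smul_apply, map_sum] at h1
    rw [derivation_sum_smul_apply, Derivation.zero_apply]
    simp only [sub_mul, Finset.sum_sub_distrib]
    rw [← h1, sub_eq_zero]
    refine Finset.sum_congr rfl fun j _ => ?_
    rw [homogeneousComponent_mul_of_isHomogeneous (hη j i)]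
    split_ifs <;> simp
  exact sub_eq_zero.1 (Fintype.linearIndependent_iff.1 hli _ h j)

/-- Independent homogeneous elements of degree at most `t` in the span of a homogeneous independent
family are not more numerous than the members of that family of degree at most `t`. -/
theorem card_degree_le_of_mem_span {I : Type*} [Fintype I]
    {η : J → Derivation K (MvPolynomial ι K) (MvPolynomial ι K)} {e : J → ℕ}
    (hη : ∀ j, HomogeneousDer (η j) (e j)) (hli : LinearIndependent (MvPolynomial ι K) η)
    {θ : I → Derivation K (MvPolynomial ι K) (MvPolynomial ι K)} {d : I → ℕ} {t : ℕ}
    (hd : ∀ i, d i ≤ t) (hθ : ∀ i, HomogeneousDer (θ i) (d i))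
    (hspan : ∀ i, θ i ∈ Submodule.span (MvPolynomial ι K) (Set.range η))
    (hli' : LinearIndependent (MvPolynomial ι K) θ) :
    Fintype.card I ≤ (Finset.univ.val.map e).countP (· ≤ t) := by
  classical
  have hfin : (η '' {j | e j ≤ t}).Finite := Set.toFinite _
  have := hfin.fintype
  -- By the degree constraint on coefficients, the `θ i` already lie in the span of the `η j` of
  -- degree at most `t`; a rank comparison finishes.
  have key := linearIndependent_le_span' θ hli' (η '' {j | e j ≤ t}) (by
    rintro _ ⟨i, rfl⟩
    obtain ⟨f, hf⟩ := (Submodule.mem_span_range_iff_exists_fun _).1 (hspan i)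
    have hθi := hθ i
    rw [← hf] at hθi
    rw [SetLike.mem_coe, ← hf]
    refine Submodule.sum_mem _ fun j _ => ?_
    by_cases hj : e j ≤ t
    · exact Submodule.smul_mem _ _ (Submodule.subset_span ⟨j, hj, rfl⟩)
    · rw [HomogeneousDer.coefficient_eq hη hli hθi j, if_neg, zero_smul]
      · exact Submodule.zero_mem _
      · exact fun h => hj (h.trans (hd i)))
  rw [Cardinal.mk_fintype, Nat.cast_le] at key
  refine key.trans ?_
  rw [Multiset.countP_map, ← Set.toFinset_card]
  calc _ ≤ ((Finset.univ.filter fun j => e j ≤ t).image η).card := by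
        refine Finset.card_le_card fun x => ?_
        simp
    _ ≤ _ := Finset.card_image_le

/-- `N` has a basis of homogeneous derivations, and `d` is the multiset of their degrees. -/
def HasHomogeneousBasis [Fintype ι]
    (N : Submodule (MvPolynomial ι K) (Derivation K (MvPolynomial ι K) (MvPolynomial ι K)))
    (d : Multiset ℕ) : Prop :=
  ∃ (θ : ι → Derivation K (MvPolynomial ι K) (MvPolynomial ι K)) (deg : ι → ℕ),
    IsBasisOfSubmodule N θ ∧ (∀ k, HomogeneousDer (θ k) (deg k)) ∧ d = Finset.univ.val.map deg

/-- Each basis lies in the span of the other, so for every `t` both have equally many members of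
degree at most `t`. -/
theorem HasHomogeneousBasis.unique [Fintype ι]
    {N : Submodule (MvPolynomial ι K) (Derivation K (MvPolynomial ι K) (MvPolynomial ι K))}
    {d e : Multiset ℕ} (hd : HasHomogeneousBasis N d) (he : HasHomogeneousBasis N e) : d = e := by
  have key : ∀ {d e : Multiset ℕ}, HasHomogeneousBasis N d → HasHomogeneousBasis N e → ∀ t,
      d.countP (· ≤ t) ≤ e.countP (· ≤ t) := by
    rintro _ _ ⟨θ, d, ⟨hθ, hθN⟩, hθd, rfl⟩ ⟨η, e, ⟨hη, hηN⟩, hηe, rfl⟩ t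
    have := card_degree_le_of_mem_span hηe hη (I := {i // d i ≤ t}) (t := t)
      (θ := fun i => θ i) (d := fun i => d i) (fun i => i.2) (fun i => hθd i)
      (fun i => by rw [hηN, ← hθN]; exact Submodule.subset_span ⟨_, rfl⟩)
      (hθ.comp _ Subtype.val_injective)
    refine le_trans (le_of_eq ?_) this
    rw [Multiset.countP_map, Fintype.card_subtype]
    rfl
  exact Multiset.eq_of_countP_le_eq fun t => le_antisymm (key hd he t) (key he hd t)

end Derivations

/-! ### Restriction of polynomials and derivations to a hyperplane -/

section HyperplaneParam

variable {K : Type*} [Field K] {ι ι' : Type*}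

/-- `L` is an isomorphism onto the hyperplane `ker α`, and `R` is the inverse of `L` there. -/
structure IsHyperplaneParam (L : (ι' → K) →ₗ[K] (ι → K)) (R : (ι → K) →ₗ[K] (ι' → K))
    (α : (ι → K) →ₗ[K] K) : Prop where
  ne_zero : α ≠ 0
  comp_eq_zero : α ∘ₗ L = 0
  left_inv : R ∘ₗ L = LinearMap.id
  right_inv : ∀ x, α x = 0 → L (R x) = x

variable {L : (ι' → K) →ₗ[K] (ι → K)} {R : (ι → K) →ₗ[K] (ι' → K)} {α : (ι → K) →ₗ[K] K}

theorem IsHyperplaneParam.exists_eq_smul (h : IsHyperplaneParam L R α) {β : (ι → K) →ₗ[K] K}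
    (hβ : β ∘ₗ L = 0) : ∃ c : K, β = c • α := by
  apply exists_eq_smul_of_ker_le
  intro x hx
  rw [LinearMap.mem_ker] at hx ⊢
  rw [← h.right_inv x hx, ← LinearMap.comp_apply, hβ, LinearMap.zero_apply]

theorem IsHyperplaneParam.exists_sub_eq_smul (h : IsHyperplaneParam L R α) (β : (ι → K) →ₗ[K] K) :
    ∃ c : K, β - β ∘ₗ L ∘ₗ R = c • α := by
  apply h.exists_eq_smul
  rw [LinearMap.sub_comp, LinearMap.comp_assoc, LinearMap.comp_assoc, h.left_inv,
    LinearMap.comp_id, sub_self]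

end HyperplaneParam

section Restriction

variable {K : Type*} [Field K] {ι ι' : Type*} [Fintype ι] [Fintype ι']

theorem substLinear_id (f : MvPolynomial ι K) :
    substLinear (LinearMap.id : (ι → K) →ₗ[K] (ι → K)) f = f := by
  have : substLinear (LinearMap.id : (ι → K) →ₗ[K] (ι → K)) = AlgHom.id K _ := by
    ext1 i
    rw [substLinear_X, LinearMap.comp_id, linearFormPoly_proj, AlgHom.id_apply]
  rw [this, AlgHom.id_apply]

variable {L : (ι' → K) →ₗ[K] (ι → K)} {R : (ι → K) →ₗ[K] (ι' → K)} {α : (ι → K) →ₗ[K] K}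

namespace IsHyperplaneParam

theorem subst_subst (h : IsHyperplaneParam L R α) (f : MvPolynomial ι' K) :
    substLinear L (substLinear R f) = f := by
  rw [substLinear_substLinear, h.left_inv, substLinear_id]

theorem subst_self (h : IsHyperplaneParam L R α) : substLinear L (linearFormPoly α) = 0 := by
  rw [substLinear_linearFormPoly, h.comp_eq_zero, ← zero_smul K (0 : (ι' → K) →ₗ[K] K),
    linearFormPoly_smul, map_zero, zero_mul]

/-- Restricting to the hyperplane and pulling back along `R` fixes each coordinate modulo `α`, hence
each polynomial. -/
theorem dvd_sub_subst (h : IsHyperplaneParam L R α) (f : MvPolynomial ι K) :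
    linearFormPoly α ∣ f - substLinear R (substLinear L f) := by
  induction f using MvPolynomial.induction_on with
  | C a => simp [← algebraMap_eq]
  | add p q hp hq =>
    rw [map_add, map_add, add_sub_add_comm]
    exact dvd_add hp hq
  | mul_X p i hp =>
    have hX : linearFormPoly α ∣ X i - substLinear R (substLinear L (X i)) := by
      obtain ⟨c, hc⟩ := h.exists_sub_eq_smul (LinearMap.proj i)
      rw [← linearFormPoly_proj, substLinear_linearFormPoly, substLinear_linearFormPoly,
        ← linearFormPoly_sub, LinearMap.comp_assoc, hc, linearFormPoly_smul]
      exact dvd_mul_left _ _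
    rw [map_mul, map_mul]
    have : p * X i - substLinear R (substLinear L p) * substLinear R (substLinear L (X i)) =
        (p - substLinear R (substLinear L p)) * X i + substLinear R (substLinear L p) *
          (X i - substLinear R (substLinear L (X i))) := by ring
    rw [this]
    exact dvd_add (hp.mul_right _) (hX.mul_left _)

theorem subst_eq_zero_iff (h : IsHyperplaneParam L R α) {f : MvPolynomial ι K} :
    substLinear L f = 0 ↔ linearFormPoly α ∣ f := by
  constructor
  · intro hf
    have := h.dvd_sub_subst f
    rwa [hf, map_zero, sub_zero] at this
  · rintro ⟨g, rfl⟩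
    rw [map_mul, h.subst_self, zero_mul]

end IsHyperplaneParam

/-- The derivation induced by `θ` on the coordinate ring of a hyperplane. -/
noncomputable def restrictDer (L : (ι' → K) →ₗ[K] (ι → K)) (R : (ι → K) →ₗ[K] (ι' → K))
    (θ : Derivation K (MvPolynomial ι K) (MvPolynomial ι K)) :
    Derivation K (MvPolynomial ι' K) (MvPolynomial ι' K) :=
  mkDerivation K fun w => substLinear L (θ (substLinear R (X w)))

theorem restrictDer_linearFormPoly_comp (L : (ι' → K) →ₗ[K] (ι → K)) (R : (ι → K) →ₗ[K] (ι' → K))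
    (θ : Derivation K (MvPolynomial ι K) (MvPolynomial ι K)) (γ : (ι' → K) →ₗ[K] K) :
    restrictDer L R θ (linearFormPoly γ) = substLinear L (θ (linearFormPoly (γ ∘ₗ R))) := by
  classical
  rw [← substLinear_linearFormPoly, linearFormPoly_eq_sum]
  simp only [map_sum, map_mul, algHom_C, algebraMap_eq, derivation_apply_C_mul]
  refine Finset.sum_congr rfl fun w _ => ?_
  rw [restrictDer, mkDerivation_X]

/-- For `θ` tangent to the hyperplane, `restrictDer` does not depend on the retraction `R`: the
forms `β` and `β ∘ L ∘ R` differ by a multiple of `α`, which `θ` sends into the ideal of `α`. -/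
theorem IsHyperplaneParam.restrictDer_apply (h : IsHyperplaneParam L R α)
    {θ : Derivation K (MvPolynomial ι K) (MvPolynomial ι K)}
    (hθ : linearFormPoly α ∣ θ (linearFormPoly α)) (β : (ι → K) →ₗ[K] K) :
    restrictDer L R θ (linearFormPoly (β ∘ₗ L)) = substLinear L (θ (linearFormPoly β)) := by
  obtain ⟨c, hc⟩ := h.exists_sub_eq_smul β
  rw [restrictDer_linearFormPoly_comp, LinearMap.comp_assoc, eq_comm, ← sub_eq_zero, ← map_sub,
    ← map_sub, ← linearFormPoly_sub, hc, linearFormPoly_smul, derivation_apply_C_mul,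
    h.subst_eq_zero_iff]
  exact hθ.mul_left _

theorem HomogeneousDer.restrictDer {θ : Derivation K (MvPolynomial ι K) (MvPolynomial ι K)}
    {d : ℕ} (hθ : HomogeneousDer θ d) (L : (ι' → K) →ₗ[K] (ι → K))
    (R : (ι → K) →ₗ[K] (ι' → K)) : HomogeneousDer (restrictDer L R θ) d := by
  intro w
  rw [← linearFormPoly_proj, restrictDer_linearFormPoly_comp]
  exact substLinear_isHomogeneous _ (hθ.apply_linearFormPoly _)

/-! ### The divisibility of `θ(α)` on the hyperplane `ker α` -/

/-- Linear forms, no two of which are proportional. -/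
structure PairwiseNonproportional {I : Type*} (β : I → (ι → K) →ₗ[K] K) : Prop where
  ne_zero : ∀ s, β s ≠ 0
  ne_smul : ∀ s t, s ≠ t → ∀ c : K, β s ≠ c • β t

theorem PairwiseNonproportional.isRelPrime {I : Type*} {β : I → (ι → K) →ₗ[K] K}
    (hβ : PairwiseNonproportional β) {s t : I} (hst : s ≠ t) :
    IsRelPrime (linearFormPoly (β s)) (linearFormPoly (β t)) := by
  rw [(linearFormPoly_prime (hβ.ne_zero s)).irreducible.isRelPrime_iff_not_dvd]
  intro hdvd
  obtain ⟨c, hc⟩ := exists_eq_smul_of_linearFormPoly_dvd hdvd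
  exact hβ.ne_smul t s hst.symm c hc

variable {I J : Type*} [Fintype I] {β : I → (ι → K) →ₗ[K] K}
  {γ : J → (ι' → K) →ₗ[K] K} {π : I → J}

-- The forms `β s` over one `t` all lie in the pencil spanned by `α` and one of them, `y`. Up to a
-- unit, `y θ(α) - α θ(y)` does not change when `y` is replaced by another such form, so all of them
-- divide it. On `α = 0` it becomes `y θ(α)`, and one factor cancels.
open Classical in
theorem IsHyperplaneParam.pow_dvd_subst (h : IsHyperplaneParam L R α)
    (hβ : PairwiseNonproportional β) (hγ : PairwiseNonproportional γ)
    (hπ : ∀ s, ∃ c : K, c ≠ 0 ∧ β s ∘ₗ L = c • γ (π s))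
    {θ : Derivation K (MvPolynomial ι K) (MvPolynomial ι K)}
    (hθ : ∀ s, linearFormPoly (β s) ∣ θ (linearFormPoly (β s))) (t : J) :
    linearFormPoly (γ t) ^ ((Finset.univ.filter fun s => π s = t).card - 1) ∣
      substLinear L (θ (linearFormPoly α)) := by
  set F := Finset.univ.filter fun s => π s = t with hF
  rcases F.eq_empty_or_nonempty with hE | ⟨s₀, hs₀⟩
  · rw [hE]; simp
  choose c hc hcL using hπ
  have hπs : ∀ s ∈ F, π s = t := fun s hs => (Finset.mem_filter.1 hs).2
  set y := linearFormPoly (β s₀)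
  set A := linearFormPoly α
  have hdvd : ∏ s ∈ F, linearFormPoly (β s) ∣ y * θ A - A * θ y := by
    refine Finset.prod_dvd_of_isRelPrime (fun s _ s' _ hss => hβ.isRelPrime hss) fun s hs => ?_
    obtain ⟨k, hk⟩ := h.exists_eq_smul (β := β s - (c s / c s₀) • β s₀) (by
      rw [LinearMap.sub_comp, LinearMap.smul_comp, hcL, hcL, hπs s hs, hπs s₀ hs₀, smul_smul,
        div_mul_cancel₀ _ (hc s₀), sub_self])
    have hk' : linearFormPoly (β s) = C (c s / c s₀) * y + C k * A := by
      rw [← linearFormPoly_smul, ← linearFormPoly_smul, ← hk, linearFormPoly_sub]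
      ring
    have hu : IsUnit (C (c s / c s₀) : MvPolynomial ι K) :=
      (IsUnit.mk0 _ (div_ne_zero (hc s) (hc s₀))).map C
    rw [← hu.dvd_mul_left]
    have hθs := hθ s
    have : C (c s / c s₀) * (y * θ A - A * θ y) =
        linearFormPoly (β s) * θ A - A * θ (linearFormPoly (β s)) := by
      rw [hk', map_add, derivation_apply_C_mul, derivation_apply_C_mul]
      ring
    rw [this]
    exact dvd_sub (dvd_mul_right _ _) (hθs.mul_left _)
  have h1 := map_dvd (substLinear L) hdvd
  rw [map_sub, map_mul, map_mul, h.subst_self, zero_mul, sub_zero, map_prod] at h1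
  have h2 : linearFormPoly (γ t) ^ F.card ∣
      linearFormPoly (γ t) * substLinear L (θ A) := by
    have hu : IsUnit (C (c s₀) : MvPolynomial ι' K) := (IsUnit.mk0 _ (hc s₀)).map C
    rw [← hu.dvd_mul_left, ← mul_assoc, ← linearFormPoly_smul, ← hπs s₀ hs₀, ← hcL s₀,
      ← substLinear_linearFormPoly]
    refine dvd_trans ?_ h1
    rw [← Finset.prod_const]
    refine Finset.prod_dvd_prod_of_dvd _ _ fun s hs => ?_
    rw [substLinear_linearFormPoly, hcL, linearFormPoly_smul, hπs s hs, hπs s₀ hs₀]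
    exact dvd_mul_left _ _
  have hpos : 0 < F.card := Finset.card_pos.2 ⟨s₀, hs₀⟩
  rw [← Nat.sub_add_cancel hpos, pow_succ'] at h2
  exact (mul_dvd_mul_iff_left (linearFormPoly_ne_zero (hγ.ne_zero t))).1 h2

/-- For a surjection `π`, the polynomial below has degree `|I| - |J|`. -/
theorem IsHyperplaneParam.exists_isHomogeneous_dvd_subst [Fintype J]
    (h : IsHyperplaneParam L R α)
    (hβ : PairwiseNonproportional β) (hγ : PairwiseNonproportional γ)
    (hπ : ∀ s, ∃ c : K, c ≠ 0 ∧ β s ∘ₗ L = c • γ (π s)) (hsurj : Function.Surjective π) :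
    ∃ b : MvPolynomial ι' K, b ≠ 0 ∧ b.IsHomogeneous (Fintype.card I - Fintype.card J) ∧
      ∀ θ : Derivation K (MvPolynomial ι K) (MvPolynomial ι K),
        (∀ s, linearFormPoly (β s) ∣ θ (linearFormPoly (β s))) →
          b ∣ substLinear L (θ (linearFormPoly α)) := by
  classical
  refine ⟨∏ t, linearFormPoly (γ t) ^ ((Finset.univ.filter fun s => π s = t).card - 1),
    ?_, ?_, ?_⟩
  · exact Finset.prod_ne_zero_iff.2 fun t _ => pow_ne_zero _ (linearFormPoly_ne_zero (hγ.ne_zero t))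
  · have hcard : Fintype.card I - Fintype.card J =
        ∑ t, ((Finset.univ.filter fun s => π s = t).card - 1) := by
      have h1 : Fintype.card I = ∑ t, (Finset.univ.filter fun s => π s = t).card :=
        Finset.card_eq_sum_card_fiberwise fun s _ => Finset.mem_coe.2 (Finset.mem_univ _)
      -- Surjectivity makes every fibre nonempty, so the truncated subtractions are true ones and
      -- sum to `|I| - |J|`.
      have h2 : ∀ t, 1 ≤ (Finset.univ.filter fun s => π s = t).card := fun t => by
        obtain ⟨s, hs⟩ := hsurj t
        exact Finset.card_pos.2 ⟨s, by simp [hs]⟩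
      rw [Finset.sum_tsub_distrib _ fun t _ => h2 t, ← h1]
      simp
    rw [hcard]
    refine IsHomogeneous.prod _ _ _ fun t _ => ?_
    have := (linearFormPoly_isHomogeneous (γ t)).pow
      ((Finset.univ.filter fun s => π s = t).card - 1)
    rwa [one_mul] at this
  · intro θ hθ
    refine Finset.prod_dvd_of_isRelPrime (fun t _ t' _ htt => (hγ.isRelPrime htt).pow) fun t _ => ?_
    convert h.pow_dvd_subst hβ hγ hπ hθ t

end Restriction

/-! ### The addition theorem -/

section Basis

variable {K : Type*} [Field K] {ι : Type*} [Fintype ι] {α : (ι → K) →ₗ[K] K} {I : Type*}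
  {β : I → (ι → K) →ₗ[K] K}

/-- The logarithmic derivations of the arrangement of the kernels of a family of linear forms. -/
noncomputable def logDerForms (β : I → (ι → K) →ₗ[K] K) :
    Submodule (MvPolynomial ι K) (Derivation K (MvPolynomial ι K) (MvPolynomial ι K)) :=
  logDerOf K (Set.range fun s => linearFormPoly (β s))

theorem mem_logDerForms {θ : Derivation K (MvPolynomial ι K) (MvPolynomial ι K)} :
    θ ∈ logDerForms β ↔ ∀ s, linearFormPoly (β s) ∣ θ (linearFormPoly (β s)) :=
  Set.forall_mem_range

/-- One form per hyperplane suffices, since forms with the same kernel differ by a scalar. -/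
theorem logDer_eq_logDerForms {𝒜 : Set (Submodule K (ι → K))} (h : 𝒜 = Set.range fun s => LinearMap.ker (β s)) :
    logDer 𝒜 = logDerForms β := by
  subst h
  ext θ
  rw [mem_logDerForms]
  constructor
  · exact fun hθ s => hθ _ ⟨β s, ⟨s, rfl⟩, rfl⟩
  · rintro hθ _ ⟨δ, ⟨s, hs : LinearMap.ker (β s) = LinearMap.ker δ⟩, rfl⟩
    obtain ⟨c, hc⟩ := exists_eq_smul_of_ker_le hs.le
    rw [hc, linearFormPoly_smul, derivation_apply_C_mul]
    exact mul_dvd_mul_left _ (hθ s)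

/-- Replacing one member `θ k` of a basis of the logarithmic derivations of the deletion by its
multiple by `α` gives a basis of those of the whole arrangement, when the restrictions to
the hyperplane of the `θ i (α)` are multiples of that of `θ k (α)`. -/
theorem isBasisOfSubmodule_of_multiples [DecidableEq ι] (hα0 : α ≠ 0)
    {θ : ι → Derivation K (MvPolynomial ι K) (MvPolynomial ι K)}
    (hθ : IsBasisOfSubmodule (logDerForms β) θ)
    {N : Submodule (MvPolynomial ι K) (Derivation K (MvPolynomial ι K) (MvPolynomial ι K))}
    (hN : ∀ η, η ∈ N ↔ η ∈ logDerForms β ∧ linearFormPoly α ∣ η (linearFormPoly α))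
    {k : ι} (hk : ¬ linearFormPoly α ∣ θ k (linearFormPoly α))
    {f : ι → MvPolynomial ι K}
    (hf : ∀ i, i ≠ k → linearFormPoly α ∣
      θ i (linearFormPoly α) - f i * θ k (linearFormPoly α)) :
    IsBasisOfSubmodule N fun i =>
      if i = k then linearFormPoly α • θ k else θ i - f i • θ k := by
  obtain ⟨hli, hspan⟩ := hθ
  have hα : Prime (linearFormPoly α) := linearFormPoly_prime hα0
  -- the expansion of a combination of the new family in the old one
  have expand : ∀ c : ι → MvPolynomial ι K,
      (∑ i, c i • (if i = k then linearFormPoly α • θ k else θ i - f i • θ k)) =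
        ∑ i, (if i = k then linearFormPoly α * c k - ∑ i ∈ Finset.univ.erase k, c i * f i
          else c i) • θ i := by
    intro c
    rw [← Finset.add_sum_erase _ _ (Finset.mem_univ k),
      ← Finset.add_sum_erase _ (fun i => (if i = k then _ else _) • θ i) (Finset.mem_univ k)]
    rw [if_pos rfl, if_pos rfl, derivation_sub_smul, sub_add_eq_add_sub, smul_smul, mul_comm (c k),
      add_sub_assoc]
    congr 1
    rw [Finset.sum_smul, ← Finset.sum_sub_distrib]
    refine Finset.sum_congr rfl fun i hi => ?_
    rw [if_neg (Finset.ne_of_mem_erase hi), if_neg (Finset.ne_of_mem_erase hi), smul_sub, smul_smul]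
  constructor
  · rw [Fintype.linearIndependent_iff]
    intro c hc
    rw [expand] at hc
    have h1 := Fintype.linearIndependent_iff.1 hli _ hc
    have h2 : ∀ i, i ≠ k → c i = 0 := fun i hi => by simpa [hi] using h1 i
    intro i
    by_cases hi : i = k
    · subst hi
      have h3 := h1 i
      rw [if_pos rfl, Finset.sum_eq_zero (fun j hj => by
        rw [h2 j (Finset.ne_of_mem_erase hj), zero_mul]), sub_zero] at h3
      exact (mul_eq_zero.1 h3).resolve_left hα.ne_zero
    · exact h2 i hi
  · apply le_antisymm
    · rw [Submodule.span_le]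
      rintro _ ⟨i, rfl⟩
      have hmem : ∀ i, θ i ∈ logDerForms β := fun i => by
        rw [← hspan]
        exact Submodule.subset_span ⟨i, rfl⟩
      rw [SetLike.mem_coe, hN]
      dsimp only
      split_ifs with hi
      · refine ⟨Submodule.smul_mem _ _ (hmem k), ?_⟩
        rw [Derivation.smul_apply]
        exact dvd_mul_right _ _
      · refine ⟨Submodule.sub_mem _ (hmem i) (Submodule.smul_mem _ _ (hmem k)), ?_⟩
        rw [Derivation.sub_apply, Derivation.smul_apply]
        exact hf i hi
    · intro η hη
      obtain ⟨hη1, hη2⟩ := (hN η).1 hη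
      rw [← hspan, Submodule.mem_span_range_iff_exists_fun] at hη1
      obtain ⟨g, rfl⟩ := hη1
      -- Modulo `α`, each `θ i (α)` is `f i * θ k (α)`, so `η(α)` is this sum times `θ k (α)`; the
      -- prime `α` does not divide the second factor.
      have hdvd : linearFormPoly α ∣ g k + ∑ i ∈ Finset.univ.erase k, g i * f i := by
        have h1 : linearFormPoly α ∣
            (g k + ∑ i ∈ Finset.univ.erase k, g i * f i) * θ k (linearFormPoly α) := by
          rw [derivation_sum_smul_apply, ← Finset.add_sum_erase _ _ (Finset.mem_univ k)] at hη2
          have h2 : linearFormPoly α ∣ ∑ i ∈ Finset.univ.erase k,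
              g i * (θ i (linearFormPoly α) - f i * θ k (linearFormPoly α)) :=
            Finset.dvd_sum fun i hi => (hf i (Finset.ne_of_mem_erase hi)).mul_left _
          have h3 := dvd_sub hη2 h2
          convert h3 using 1
          rw [add_sub_assoc, ← Finset.sum_sub_distrib, add_mul, Finset.sum_mul]
          congr 1
          refine Finset.sum_congr rfl fun i _ => ?_
          ring
        exact (hα.dvd_or_dvd h1).resolve_right hk
      obtain ⟨b, hb⟩ := hdvd
      rw [Submodule.mem_span_range_iff_exists_fun]
      -- The new coefficient at `k` is the quotient by `α`: by `expand`, the old coefficient `g k`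
      -- is recovered as `α * b` minus the corrections.
      refine ⟨Function.update g k b, ?_⟩
      rw [expand]
      refine Finset.sum_congr rfl fun i _ => ?_
      split_ifs with hi
      · subst hi
        rw [Function.update_self, ← hb, add_sub_assoc, ← Finset.sum_sub_distrib,
          Finset.sum_eq_zero, add_zero]
        intro j hj
        rw [Function.update_of_ne (Finset.ne_of_mem_erase hj), sub_self]
      · rw [Function.update_of_ne hi]

end Basis

section Addition

variable {K : Type*} [Field K] {ι ι' : Type*} [Fintype ι] [Fintype ι']

/-- Tangent members of a basis of the deletion stay independent on the hyperplane. A lifted relation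
is `α` times a derivation that is again logarithmic, so independence upstairs makes every lifted
coefficient divisible by `α`. -/
theorem eq_zero_of_sum_smul_restrictDer_eq_zero
    {L : (ι' → K) →ₗ[K] (ι → K)} {R : (ι → K) →ₗ[K] (ι' → K)} {α : (ι → K) →ₗ[K] K}
    (h : IsHyperplaneParam L R α) {I : Type*} {β : I → (ι → K) →ₗ[K] K}
    (hβ : ∀ s, β s ∘ₗ L ≠ 0) {T : Type*} [Fintype T]
    {θ : T → Derivation K (MvPolynomial ι K) (MvPolynomial ι K)}
    (hli : LinearIndependent (MvPolynomial ι K) θ)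
    (hspan : Submodule.span (MvPolynomial ι K) (Set.range θ) = logDerForms β)
    {f : T → MvPolynomial ι' K}
    (hf : ∀ k, f k ≠ 0 → linearFormPoly α ∣ θ k (linearFormPoly α))
    (h0 : ∑ k, f k • restrictDer L R (θ k) = 0) (k : T) : f k = 0 := by
  classical
  -- a lift of the relation to the ambient space vanishes modulo `α`
  set η := ∑ k, substLinear R (f k) • θ k with hη
  have hdvd : ∀ i, linearFormPoly α ∣ η (X i) := by
    intro i
    rw [← h.subst_eq_zero_iff, hη, derivation_sum_smul_apply, map_sum]
    have h1 := congrArg (fun D : Derivation K (MvPolynomial ι' K) (MvPolynomial ι' K) =>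
      D (linearFormPoly (LinearMap.proj i ∘ₗ L))) h0
    simp only [derivation_sum_smul_apply, Derivation.zero_apply] at h1
    rw [← h1]
    refine Finset.sum_congr rfl fun k _ => ?_
    rw [map_mul, h.subst_subst]
    by_cases hk : f k = 0
    · rw [hk, zero_mul, zero_mul]
    · rw [h.restrictDer_apply (hf k hk), linearFormPoly_proj]
  choose g hg using hdvd
  have hηg : η = linearFormPoly α • mkDerivation K g := by
    refine derivation_ext fun i => ?_
    rw [hg, Derivation.smul_apply, mkDerivation_X, smul_eq_mul]
  -- Dividing by `α` keeps the derivation logarithmic: `β s` is prime and does not divide `α`, as it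
  -- is not zero on the hyperplane.
  have hmem : mkDerivation K g ∈ logDerForms β := by
    rw [mem_logDerForms]
    intro s
    have hηs : η ∈ logDerForms β := by
      rw [← hspan]
      exact Submodule.sum_mem _ fun k _ => Submodule.smul_mem _ _ (Submodule.subset_span ⟨k, rfl⟩)
    have hs := mem_logDerForms.1 hηs s
    rw [hηg, Derivation.smul_apply, smul_eq_mul] at hs
    have hβs : β s ≠ 0 := by
      intro h'
      exact hβ s (by rw [h', LinearMap.zero_comp])
    refine ((linearFormPoly_prime hβs).dvd_or_dvd hs).resolve_left fun h' => ?_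
    obtain ⟨c, hc⟩ := exists_eq_smul_of_linearFormPoly_dvd h'
    have hc0 : c ≠ 0 := by
      rintro rfl
      exact h.ne_zero (by rw [hc, zero_smul])
    refine hβ s ?_
    have := h.comp_eq_zero
    rw [hc, LinearMap.smul_comp] at this
    exact (smul_eq_zero.1 this).resolve_left hc0
  rw [← hspan, Submodule.mem_span_range_iff_exists_fun] at hmem
  obtain ⟨c, hc⟩ := hmem
  have hrel : ∑ k, (substLinear R (f k) - linearFormPoly α * c k) • θ k = 0 := by
    simp only [derivation_sub_smul, Finset.sum_sub_distrib, mul_smul, ← Finset.smul_sum]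
    rw [hc, ← hηg, hη, sub_self]
  have := Fintype.linearIndependent_iff.1 hli _ hrel k
  rw [← h.subst_subst (f k), sub_eq_zero.1 this, map_mul, h.subst_self, zero_mul]

variable {L : (ι' → K) →ₗ[K] (ι → K)} {R : (ι → K) →ₗ[K] (ι' → K)} {α : (ι → K) →ₗ[K] K}
  {I J : Type*} {β : I → (ι → K) →ₗ[K] K} {γ : J → (ι' → K) →ₗ[K] K} {π : I → J}

/-- The addition theorem: if the deletion of a hyperplane is free with exponents `a, d` and
the restriction to it is free with exponents `d`, then the arrangement is free with
exponents `a + 1, d`. The exponent `a` is required to be the difference of the numbers of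
hyperplanes of the deletion and of the restriction. -/
theorem HasHomogeneousBasis.addition [Fintype I] [Fintype J] (h : IsHyperplaneParam L R α)
    (hβ : PairwiseNonproportional β) (hγ : PairwiseNonproportional γ)
    (hπ : ∀ s, ∃ c : K, c ≠ 0 ∧ β s ∘ₗ L = c • γ (π s)) (hsurj : Function.Surjective π)
    {a : ℕ} {d : Multiset ℕ} (hcard : Fintype.card I = Fintype.card J + a)
    (hdel : HasHomogeneousBasis (logDerForms β) (a ::ₘ d))
    (hres : HasHomogeneousBasis (logDerForms γ) d)
    {N : Submodule (MvPolynomial ι K) (Derivation K (MvPolynomial ι K) (MvPolynomial ι K))}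
    (hN : ∀ η, η ∈ N ↔ η ∈ logDerForms β ∧ linearFormPoly α ∣ η (linearFormPoly α)) :
    HasHomogeneousBasis N ((a + 1) ::ₘ d) := by
  classical
  obtain ⟨b, hb0, hbh, hb⟩ := h.exists_isHomogeneous_dvd_subst hβ hγ hπ hsurj
  rw [hcard, Nat.add_sub_cancel_left] at hbh
  obtain ⟨θ, deg, hθ, hθdeg, hdegs⟩ := hdel
  have hθmem : ∀ i, θ i ∈ logDerForms β := fun i => by
    rw [← hθ.2]
    exact Submodule.subset_span ⟨i, rfl⟩
  -- the restrictions of the `θ i (α)` are homogeneous multiples of `b`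
  have hmul : ∀ i, ∃ c : MvPolynomial ι' K, (c.IsHomogeneous (deg i - a) ∧ (c ≠ 0 → a ≤ deg i)) ∧
      substLinear L (θ i (linearFormPoly α)) = c * b := by
    intro i
    obtain ⟨c, hc⟩ := hb (θ i) (mem_logDerForms.1 (hθmem i))
    rw [mul_comm] at hc
    have hhom := substLinear_isHomogeneous L ((hθdeg i).apply_linearFormPoly α)
    have h1 := homogeneousComponent_of_mem (m := deg i) ((mem_homogeneousSubmodule _ _).2 hhom)
    rw [if_pos rfl, hc, homogeneousComponent_mul_of_isHomogeneous hbh] at h1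
    -- The product with `b` is homogeneous of degree `deg i`, so only this component of the quotient
    -- contributes.
    refine ⟨if a ≤ deg i then homogeneousComponent (deg i - a) c else 0,
      ⟨isHomogeneous_ite_homogeneousComponent c, fun hne => ?_⟩, ?_⟩
    · by_contra hlt
      exact hne (if_neg hlt)
    · rw [hc, ← h1]
      split_ifs <;> simp
  choose c hc hcb using hmul
  have hc_iff : ∀ i, linearFormPoly α ∣ θ i (linearFormPoly α) ↔ c i = 0 := fun i => by
    rw [← h.subst_eq_zero_iff, hcb, mul_eq_zero, or_iff_left hb0]
  -- one of them is `b` up to a nonzero scalar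
  obtain ⟨k, hkdeg, hk⟩ : ∃ k, deg k = a ∧ c k ≠ 0 := by
    by_contra! hcon
    have hle : ∀ i, deg i ≤ a → c i = 0 := by
      intro i hi
      by_contra hne
      exact hne (hcon i (le_antisymm hi ((hc i).2 hne)))
    -- Otherwise all `θ i` of degree at most `a` are tangent and restrict to independent logarithmic
    -- derivations of the restriction. But `a ::ₘ d` has one more member of degree at most `a` than
    -- `d`.
    obtain ⟨η, e, hη, hηdeg, rfl⟩ := hres
    have hcount := card_degree_le_of_mem_span hηdeg hη.1 (I := {i // deg i ≤ a}) (t := a)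
      (θ := fun i => restrictDer L R (θ i)) (d := fun i => deg i) (fun i => i.2)
      (fun i => (hθdeg i).restrictDer L R)
      (by
        intro i
        rw [hη.2, mem_logDerForms]
        intro t
        obtain ⟨s, rfl⟩ := hsurj t
        obtain ⟨r, hr, hrs⟩ := hπ s
        have hu : IsUnit (C r : MvPolynomial ι' K) := (IsUnit.mk0 _ hr).map C
        rw [← hu.dvd_mul_left, ← hu.mul_left_dvd, ← derivation_apply_C_mul,
          ← linearFormPoly_smul, ← hrs, h.restrictDer_apply ((hc_iff _).2 (hle _ i.2)),
          ← substLinear_linearFormPoly]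
        exact map_dvd _ (mem_logDerForms.1 (hθmem i) s))
      (by
        rw [Fintype.linearIndependent_iff]
        intro f hf i
        have key := eq_zero_of_sum_smul_restrictDer_eq_zero h (β := β) (fun s hs => by
            obtain ⟨r, hr, hrs⟩ := hπ s
            rw [hs] at hrs
            exact (smul_ne_zero hr (hγ.ne_zero _)) hrs.symm) hθ.1 hθ.2
          (f := fun i => if hi : deg i ≤ a then f ⟨i, hi⟩ else 0)
          (fun i hi => by
            rw [hc_iff]
            by_contra hci
            refine hi (dif_neg fun hia => hci (hle i hia)))
          (by
            rw [← hf, ← Finset.sum_filter_add_sum_filter_not Finset.univ (fun i => deg i ≤ a)]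
            rw [Finset.sum_eq_zero (s := Finset.univ.filter fun i => ¬ deg i ≤ a), add_zero]
            · rw [← Finset.sum_subtype_of_mem (p := fun i => deg i ≤ a) _
                (by simp)]
              refine Finset.sum_congr ?_ fun i _ => ?_
              · ext i
                simp [i.2]
              · rw [dif_pos i.2]
            · intro i hi
              rw [dif_neg (Finset.mem_filter.1 hi).2, zero_smul]) i
        rwa [dif_pos i.2] at key)
    have h1 : (Finset.univ.val.map deg).countP (· ≤ a) = Fintype.card {i // deg i ≤ a} := by
      rw [Multiset.countP_map, Fintype.card_subtype]
      rfl
    rw [← h1, ← hdegs, Multiset.countP_cons_of_pos (p := (· ≤ a)) _ (le_refl a)] at hcount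
    omega
  obtain ⟨r, hr⟩ : ∃ r : K, c k = C r := by
    have := (hc k).1
    rw [hkdeg, Nat.sub_self] at this
    exact ⟨_, totalDegree_eq_zero_iff_eq_C.1 ((totalDegree_zero_iff_isHomogeneous _).2 this)⟩
  have hr0 : r ≠ 0 := by
    rintro rfl
    exact hk (by rw [hr, map_zero])
  -- As `c k` is the constant `r`, the restriction of `θ i (α)` is `c i / r` times that of `θ k
  -- (α)`; `R` lifts this quotient.
  let f : ι → MvPolynomial ι K := fun i => if i = k then 0 else substLinear R (C r⁻¹ * c i)
  have hfhom : ∀ i, (f i).IsHomogeneous (deg i - a) := by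
    intro i
    simp only [f]
    split_ifs
    · exact isHomogeneous_zero _ _ _
    · exact substLinear_isHomogeneous _ ((hc i).1.C_mul _)
  refine ⟨_, Function.update deg k (a + 1),
    isBasisOfSubmodule_of_multiples h.ne_zero hθ hN ((hc_iff k).not.2 hk) (f := f) ?_, ?_, ?_⟩
  · intro i hi
    rw [← h.subst_eq_zero_iff, map_sub, map_mul, hcb, hcb, hr]
    simp only [f, if_neg hi]
    rw [h.subst_subst, sub_eq_zero]
    have hrr : (C r⁻¹ : MvPolynomial ι' K) * C r = 1 := by
      rw [← C_mul, inv_mul_cancel₀ hr0, C_1]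
    linear_combination -(c i * b) * hrr
  · intro i
    split_ifs with hi
    · subst hi
      rw [Function.update_self, add_comm, ← hkdeg]
      exact (hθdeg i).smul (linearFormPoly_isHomogeneous α)
    · rw [Function.update_of_ne hi]
      refine (hθdeg i).sub ?_
      -- Only for `c i ≠ 0` is `a ≤ deg i` known, so that `deg i - a + a = deg i`.
      by_cases hci : c i = 0
      · have : f i = 0 := by simp only [f, if_neg hi, hci, mul_zero, map_zero]
        rw [this, zero_smul]
        exact fun j => isHomogeneous_zero _ _ _
      · have := (hθdeg k).smul (hfhom i)
        rwa [hkdeg, Nat.sub_add_cancel ((hc i).2 hci)] at this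
  · have huniv : (Finset.univ : Finset ι).val = k ::ₘ (Finset.univ.erase k).val := by
      rw [← Finset.insert_val_of_notMem (Finset.notMem_erase k _),
        Finset.insert_erase (Finset.mem_univ k)]
    rw [huniv, Multiset.map_cons] at hdegs ⊢
    rw [hkdeg] at hdegs
    rw [Function.update_self, (Multiset.cons_inj_right a).1 hdegs]
    congr 1
    refine Multiset.map_congr rfl fun i hi => ?_
    rw [Function.update_of_ne (Finset.ne_of_mem_erase hi)]

end Addition

/-! ### Coordinate hyperplanes -/

section Coordinates

variable {K : Type*} [Field K] {ι : Type*} [Fintype ι]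

open Classical in
/-- An arrangement of coordinate hyperplanes is free. -/
theorem hasHomogeneousBasis_of_coordinates (T : ι → Prop)
    {N : Submodule (MvPolynomial ι K) (Derivation K (MvPolynomial ι K) (MvPolynomial ι K))}
    (hN : ∀ η, η ∈ N ↔ ∀ i, T i → (X i : MvPolynomial ι K) ∣ η (X i)) :
    HasHomogeneousBasis N (Finset.univ.val.map fun i => if T i then 1 else 0) := by
  -- `p i` generates the ideal of admissible `i`-th coefficients, so the module is a direct sum of
  -- these ideals.
  let p : ι → MvPolynomial ι K := fun i => if T i then X i else 1
  have hp : ∀ i, p i ≠ 0 := fun i => by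
    simp only [p]
    split_ifs
    · exact X_ne_zero i
    · exact one_ne_zero
  have hp_iff : ∀ η, η ∈ N ↔ ∀ i, p i ∣ η (X i) := fun η => by
    rw [hN]
    refine forall_congr' fun i => ?_
    by_cases hi : T i <;> simp [p, hi]
  have happly : ∀ (c : ι → MvPolynomial ι K) (i : ι),
      (∑ k, c k • mkDerivation K (Pi.single k (p k))) (X i) = c i * p i := by
    intro c i
    rw [derivation_sum_smul_apply, Finset.sum_eq_single i]
    · rw [mkDerivation_X, Pi.single_eq_same]
    · intro k _ hk
      rw [mkDerivation_X, Pi.single_eq_of_ne hk.symm, mul_zero]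
    · simp
  refine ⟨fun i => mkDerivation K (Pi.single i (p i)), _, ⟨?_, ?_⟩, ?_, rfl⟩
  · rw [Fintype.linearIndependent_iff]
    intro c hc i
    have := happly c i
    rw [hc, Derivation.zero_apply, eq_comm, mul_eq_zero] at this
    exact this.resolve_right (hp i)
  · apply le_antisymm
    · rw [Submodule.span_le]
      rintro _ ⟨k, rfl⟩
      rw [SetLike.mem_coe, hp_iff]
      intro i
      rw [mkDerivation_X]
      by_cases hk : i = k
      · subst hk
        rw [Pi.single_eq_same]
      · rw [Pi.single_eq_of_ne hk]
        exact dvd_zero _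
    · intro η hη
      choose c hc using (hp_iff η).1 hη
      rw [Submodule.mem_span_range_iff_exists_fun]
      refine ⟨c, derivation_ext fun i => ?_⟩
      rw [happly, hc, mul_comm]
  · intro k i
    rw [mkDerivation_X]
    by_cases hk : i = k
    · subst hk
      rw [Pi.single_eq_same]
      by_cases hi : T i
      · simp only [p, if_pos hi]
        exact isHomogeneous_X K i
      · simp only [p, if_neg hi]
        exact isHomogeneous_one ι K
    · rw [Pi.single_eq_of_ne hk]
      exact isHomogeneous_zero _ _ _

end Coordinates

/-! ### Arrangements of gain graphs -/

section Realization

/-- `α` and `β` are equal up to a nonzero scalar. -/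
def Proportional {K E : Type*} [Field K] [AddCommGroup E] [Module K E] (α β : E) : Prop :=
  ∃ c : K, c ≠ 0 ∧ α = c • β

section Proportional

variable {K E : Type*} [Field K] [AddCommGroup E] [Module K E] {α β δ : E}

theorem Proportional.refl (α : E) : Proportional (K := K) α α :=
  ⟨1, one_ne_zero, (one_smul K α).symm⟩

theorem Proportional.symm (h : Proportional (K := K) α β) : Proportional (K := K) β α := by
  obtain ⟨c, hc, rfl⟩ := h
  exact ⟨c⁻¹, inv_ne_zero hc, by rw [smul_smul, inv_mul_cancel₀ hc, one_smul]⟩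

theorem Proportional.trans (h : Proportional (K := K) α β) (h' : Proportional (K := K) β δ) :
    Proportional (K := K) α δ := by
  obtain ⟨c, hc, rfl⟩ := h
  obtain ⟨d, hd, rfl⟩ := h'
  exact ⟨c * d, mul_ne_zero hc hd, smul_smul _ _ _⟩

theorem Proportional.comp {E' : Type*} [AddCommGroup E'] [Module K E'] {α β : E →ₗ[K] K}
    (h : Proportional (K := K) α β) (L : E' →ₗ[K] E) :
    Proportional (K := K) (α ∘ₗ L) (β ∘ₗ L) := by
  obtain ⟨c, hc, rfl⟩ := h
  exact ⟨c, hc, LinearMap.smul_comp _ _ _⟩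

theorem Proportional.ker_eq {α β : E →ₗ[K] K} (h : Proportional (K := K) α β) :
    LinearMap.ker α = LinearMap.ker β := by
  obtain ⟨c, hc, rfl⟩ := h
  exact LinearMap.ker_smul _ _ hc

end Proportional

variable {K : Type*} [Field K] {V G : Type*} [AddGroup G] {ι B : Type*}

/-- The forms of the arrangement of a gain graph: a family `base` of forms which are always present
and the forms `φ a` of (representatives `a` of) the edges. -/
noncomputable def gainForms (base : B → (ι → K) →ₗ[K] K) (φ : GainDart V G → (ι → K) →ₗ[K] K)
    (Γ : SimpleGainGraph V G) : B ⊕ Γ.edges → (ι → K) →ₗ[K] K :=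
  Sum.elim base fun e => φ (Quotient.out (s := gainSetoid V G) e.1)

/-- The forms `base` and `φ a` are pairwise not proportional, except that the form of a directed
edge is proportional to that of its reversal. -/
structure IsGainRealization (base : B → (ι → K) →ₗ[K] K) (φ : GainDart V G → (ι → K) →ₗ[K] K) :
    Prop where
  base_pairwise : PairwiseNonproportional base
  ne_zero : ∀ a, φ a ≠ 0
  rev : ∀ a, Proportional (K := K) (φ a.rev) (φ a)
  eq_or_eq_rev : ∀ a b (c : K), φ a = c • φ b → a = b ∨ a = b.rev
  base_ne_smul : ∀ s a (c : K), base s ≠ c • φ a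

variable {base : B → (ι → K) →ₗ[K] K} {φ : GainDart V G → (ι → K) →ₗ[K] K}

/-- The chosen representative of an edge is the given directed edge or its reversal, so the choice
in `gainForms` only affects scalars. -/
theorem IsGainRealization.proportional_out (h : IsGainRealization base φ) (a : GainDart V G) :
    Proportional (K := K)
      (φ (Quotient.out (s := gainSetoid V G) (Quotient.mk (gainSetoid V G) a))) (φ a) := by
  rcases (Quotient.exact (Quotient.out_eq (s := gainSetoid V G) (Quotient.mk _ a)) :
    (_ : GainDart V G) = _ ∨ _ = _) with h1 | h1
  · rw [h1]
    exact Proportional.refl _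
  · rw [h1]
    exact h.rev a

theorem IsGainRealization.pairwiseNonproportional (h : IsGainRealization base φ)
    (Γ : SimpleGainGraph V G) : PairwiseNonproportional (gainForms base φ Γ) := by
  constructor
  · rintro (s | e)
    · exact h.base_pairwise.ne_zero s
    · exact h.ne_zero _
  · rintro (s | e) (t | f) hne c
    · exact h.base_pairwise.ne_smul s t (fun h' => hne (congrArg _ h')) c
    · exact h.base_ne_smul _ _ c
    · intro hc
      have hc0 : c ≠ 0 := by
        rintro rfl
        rw [zero_smul] at hc
        exact h.ne_zero _ hc
      refine h.base_ne_smul t (Quotient.out (s := gainSetoid V G) e.1) c⁻¹ ?_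
      change φ _ = c • base t at hc
      rw [hc, smul_smul, inv_mul_cancel₀ hc0, one_smul]
    · intro hc
      refine hne (congrArg _ (Subtype.ext ?_))
      rw [← Quotient.out_eq (s := gainSetoid V G) e.1, ← Quotient.out_eq (s := gainSetoid V G) f.1]
      exact Quotient.sound (h.eq_or_eq_rev _ _ c hc)

theorem Proportional.linearFormPoly_dvd_iff [Fintype ι] {α β : (ι → K) →ₗ[K] K}
    (h : Proportional (K := K) α β) (θ : Derivation K (MvPolynomial ι K) (MvPolynomial ι K)) :
    linearFormPoly α ∣ θ (linearFormPoly α) ↔ linearFormPoly β ∣ θ (linearFormPoly β) := by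
  obtain ⟨c, hc, rfl⟩ := h
  have hu : IsUnit (C c : MvPolynomial ι K) := (IsUnit.mk0 _ hc).map C
  rw [linearFormPoly_smul, derivation_apply_C_mul, hu.mul_left_dvd, hu.dvd_mul_left]

theorem IsGainRealization.mem_logDerForms_iff_delete [Fintype ι] (h : IsGainRealization base φ)
    (Γ : SimpleGainGraph V G) (i j : V) (g : G) (hij : i ≠ j)
    (he : GainEdge.mk i j g hij ∈ Γ.edges)
    (η : Derivation K (MvPolynomial ι K) (MvPolynomial ι K)) :
    η ∈ logDerForms (gainForms base φ Γ) ↔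
      η ∈ logDerForms (gainForms base φ (Γ.delete (GainEdge.mk i j g hij))) ∧
        linearFormPoly (φ ⟨i, j, g, hij⟩) ∣ η (linearFormPoly (φ ⟨i, j, g, hij⟩)) := by
  rw [← (h.proportional_out ⟨i, j, g, hij⟩).linearFormPoly_dvd_iff, mem_logDerForms,
    mem_logDerForms]
  constructor
  · intro hη
    refine ⟨?_, hη (Sum.inr ⟨_, he⟩)⟩
    rintro (s | ⟨e, he'⟩)
    · exact hη (Sum.inl s)
    · exact hη (Sum.inr ⟨e, he'.1⟩)
  · rintro ⟨h1, h2⟩ (s | ⟨e, he'⟩)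
    · exact h1 (Sum.inl s)
    · by_cases hee : e = GainEdge.mk i j g hij
      · subst hee
        exact h2
      · exact h1 (Sum.inr ⟨e, he', hee⟩)

/-- The forms `base'`, `φ'` for graphs on `V \ {i}` are the restrictions of the forms `base`, `φ` to
the hyperplane of the directed edge `(i, j, g)`, parametrized by `L`. -/
structure IsContractionMap {ι' B' : Type*} (base : B → (ι → K) →ₗ[K] K)
    (φ : GainDart V G → (ι → K) →ₗ[K] K) {i j : V} {g : G} (hij : i ≠ j)
    (base' : B' → (ι' → K) →ₗ[K] K) (φ' : GainDart {w : V // w ≠ i} G → (ι' → K) →ₗ[K] K)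
    (L : (ι' → K) →ₗ[K] (ι → K)) : Prop where
  base_map : ∀ s, ∃ t, Proportional (K := K) (base s ∘ₗ L) (base' t)
  base_surj : ∀ t, ∃ s, Proportional (K := K) (base s ∘ₗ L) (base' t)
  keep : ∀ (u v : {w : V // w ≠ i}) (h : G) (huv : u ≠ v),
    Proportional (K := K) (φ ⟨u, v, h, fun H => huv (Subtype.ext H)⟩ ∘ₗ L) (φ' ⟨u, v, h, huv⟩)
  move : ∀ (k : {w : V // w ≠ i}) (h : G) (hk : k ≠ ⟨j, hij.symm⟩),
    Proportional (K := K) (φ ⟨k, i, h, k.2⟩ ∘ₗ L) (φ' ⟨k, ⟨j, hij.symm⟩, h + g, hk⟩)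
  parallel : ∀ h : G, h + g ≠ 0 →
    ∃ t, Proportional (K := K) (φ ⟨j, i, h, hij.symm⟩ ∘ₗ L) (base' t)

namespace IsContractionMap

variable {ι' B' : Type*} {base' : B' → (ι' → K) →ₗ[K] K} {i j : V} {g : G} {hij : i ≠ j}
  {φ' : GainDart {w : V // w ≠ i} G → (ι' → K) →ₗ[K] K} {L : (ι' → K) →ₗ[K] (ι → K)}

/-- An edge at `i` moves to `j`, unless its other end is `j`; then it is parallel to the contracted
edge and its form restricts to a base form. -/
theorem exists_of_incident (hL : IsContractionMap base φ (g := g) hij base' φ' L)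
    (h' : IsGainRealization base' φ') (Γ : SimpleGainGraph V G) {k : V} (hk : k ≠ i) {x : G}
    (hmem : GainEdge.mk k i x hk ∈ (Γ.delete (GainEdge.mk i j g hij)).edges) :
    ∃ t, Proportional (K := K) (φ ⟨k, i, x, hk⟩ ∘ₗ L)
      (gainForms base' φ' (Γ.contract i j g hij) t) := by
  by_cases hkj : k = j
  · subst hkj
    -- If `x + g = 0`, this edge would be the deleted one, read backwards.
    obtain ⟨t, ht⟩ := hL.parallel x fun h0 => hmem.2 (by
      rw [Set.mem_singleton_iff, GainEdge.mk_eq_mk_iff]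
      exact Or.inr ⟨rfl, rfl, eq_neg_of_add_eq_zero_left h0⟩)
    exact ⟨Sum.inl t, ht⟩
  · have hne : (⟨k, hk⟩ : {w : V // w ≠ i}) ≠ ⟨j, hij.symm⟩ := fun H => hkj (Subtype.ext_iff.1 H)
    exact ⟨Sum.inr ⟨_, Or.inr ⟨⟨k, hk⟩, x, hne, hmem.1, rfl⟩⟩,
      (hL.move ⟨k, hk⟩ x hne).trans (h'.proportional_out _).symm⟩

theorem exists_map (hL : IsContractionMap base φ (g := g) hij base' φ' L)
    (h : IsGainRealization base φ) (h' : IsGainRealization base' φ') (Γ : SimpleGainGraph V G)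
    (s : B ⊕ (Γ.delete (GainEdge.mk i j g hij)).edges) :
    ∃ t, Proportional (K := K) (gainForms base φ (Γ.delete (GainEdge.mk i j g hij)) s ∘ₗ L)
      (gainForms base' φ' (Γ.contract i j g hij) t) := by
  rcases s with s | ⟨e, he⟩
  · obtain ⟨t, ht⟩ := hL.base_map s
    exact ⟨Sum.inl t, ht⟩
  · induction e using Quotient.inductionOn with | _ a => ?_
    obtain ⟨u, v, x, huv⟩ := a
    suffices ∃ t, Proportional (K := K) (φ ⟨u, v, x, huv⟩ ∘ₗ L)
        (gainForms base' φ' (Γ.contract i j g hij) t) by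
      obtain ⟨t, ht⟩ := this
      exact ⟨t, ((h.proportional_out ⟨u, v, x, huv⟩).comp L).trans ht⟩
    by_cases hv : v = i
    · subst hv
      exact hL.exists_of_incident h' Γ huv he
    by_cases hu : u = i
    · subst hu
      have hrev : GainEdge.mk u v x huv = GainEdge.mk v u (-x) huv.symm :=
        GainEdge.mk_eq_mk_iff.2 (Or.inr ⟨rfl, rfl, (neg_neg x).symm⟩)
      obtain ⟨t, ht⟩ := hL.exists_of_incident h' Γ huv.symm (x := -x) (by rw [← hrev]; exact he)
      exact ⟨t, ((h.rev ⟨u, v, x, huv⟩).symm.comp L).trans ht⟩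
    · have hne : (⟨u, hu⟩ : {w : V // w ≠ i}) ≠ ⟨v, hv⟩ := fun H => huv (Subtype.ext_iff.1 H)
      exact ⟨Sum.inr ⟨_, Or.inl ⟨⟨u, hu⟩, ⟨v, hv⟩, x, hne, he.1, rfl⟩⟩,
        (hL.keep ⟨u, hu⟩ ⟨v, hv⟩ x hne).trans (h'.proportional_out _).symm⟩

theorem exists_preimage (hL : IsContractionMap base φ (g := g) hij base' φ' L)
    (h : IsGainRealization base φ) (h' : IsGainRealization base' φ') (Γ : SimpleGainGraph V G)
    (t : B' ⊕ (Γ.contract i j g hij).edges) :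
    ∃ s, Proportional (K := K) (gainForms base φ (Γ.delete (GainEdge.mk i j g hij)) s ∘ₗ L)
      (gainForms base' φ' (Γ.contract i j g hij) t) := by
  rcases t with t | ⟨f, ⟨u, v, x, huv, hmem, rfl⟩ | ⟨k, x, hk, hmem, rfl⟩⟩
  · obtain ⟨s, hs⟩ := hL.base_surj t
    exact ⟨Sum.inl s, hs⟩
  · refine ⟨Sum.inr ⟨_, hmem, ?_⟩, ((h.proportional_out _).comp L).trans
      ((hL.keep u v x huv).trans (h'.proportional_out _).symm)⟩
    rw [Set.mem_singleton_iff, GainEdge.mk_eq_mk_iff]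
    rintro (⟨hu, -⟩ | ⟨-, hv, -⟩)
    · exact u.2 hu
    · exact v.2 hv
  · refine ⟨Sum.inr ⟨_, hmem, ?_⟩, ((h.proportional_out _).comp L).trans
      ((hL.move k x hk).trans (h'.proportional_out _).symm)⟩
    rw [Set.mem_singleton_iff, GainEdge.mk_eq_mk_iff]
    rintro (⟨hu, -⟩ | ⟨hkj, -⟩)
    · exact k.2 hu
    · exact hk (Subtype.ext hkj)

/-- The addition theorem for the arrangements of gain graphs. -/
theorem addition [Fintype ι] [Fintype ι'] [Fintype B] [Fintype B']
    (hL : IsContractionMap base φ (g := g) hij base' φ' L)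
    (h : IsGainRealization base φ) (h' : IsGainRealization base' φ')
    {R : (ι → K) →ₗ[K] (ι' → K)} (hLR : IsHyperplaneParam L R (φ ⟨i, j, g, hij⟩))
    (Γ : SimpleGainGraph V G) (he : GainEdge.mk i j g hij ∈ Γ.edges) {a : ℕ} {d : Multiset ℕ}
    (hcard : Fintype.card B + (Γ.delete (GainEdge.mk i j g hij)).edges.ncard =
      Fintype.card B' + (Γ.contract i j g hij).edges.ncard + a)
    (hdel : HasHomogeneousBasis
      (logDerForms (gainForms base φ (Γ.delete (GainEdge.mk i j g hij)))) (a ::ₘ d))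
    (hcon : HasHomogeneousBasis (logDerForms (gainForms base' φ' (Γ.contract i j g hij))) d) :
    HasHomogeneousBasis (logDerForms (gainForms base φ Γ)) ((a + 1) ::ₘ d) := by
  have := (Γ.delete (GainEdge.mk i j g hij)).finite_edges.fintype
  have := (Γ.contract i j g hij).finite_edges.fintype
  choose π hπ using hL.exists_map h h' Γ
  refine HasHomogeneousBasis.addition hLR (h.pairwiseNonproportional _)
    (h'.pairwiseNonproportional _) (π := π) hπ ?_ ?_ hdel hcon
    (h.mem_logDerForms_iff_delete Γ i j g hij he)
  · intro t
    obtain ⟨s, hs⟩ := hL.exists_preimage h h' Γ t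
    refine ⟨s, ?_⟩
    -- Nonproportionality forces `π s = t`, whichever index was chosen for `s`.
    by_contra hne
    obtain ⟨c, -, hc⟩ := (hπ s).symm.trans hs
    exact (h'.pairwiseNonproportional _).ne_smul _ _ hne c hc
  · rw [Fintype.card_sum, Fintype.card_sum, Fintype.card_eq_nat_card (α := ↥(SimpleGainGraph.edges _)),
      Fintype.card_eq_nat_card (α := ↥(Γ.contract i j g hij).edges)]
    exact hcard

end IsContractionMap

end Realization

/-! ### The cone of the affinographic arrangement -/

section Cone

variable {K : Type*} [Field K] {V : Type u} {G : Type v}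

/-- The form `z`. -/
noncomputable def coneBase (K : Type*) [Field K] (V : Type u) :
    Unit → (Option V → K) →ₗ[K] K :=
  fun _ => LinearMap.proj none

/-- The form `x_i - x_j - κ(g) z`. -/
noncomputable def coneDartForm (κ : G → K) (a : GainDart V G) : (Option V → K) →ₗ[K] K :=
  (LinearMap.proj (some a.fst) : (Option V → K) →ₗ[K] K) - LinearMap.proj (some a.snd) -
    κ a.gain • LinearMap.proj none

theorem coneDartForm_apply (κ : G → K) (a : GainDart V G) (x : Option V → K) :
    coneDartForm κ a x = x (some a.fst) - x (some a.snd) - κ a.gain * x none :=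
  rfl

variable [AddGroup G]

/-- The definition of `cone` allows any equation of an affine hyperplane; translating to a point of
it shows that the equation is unique up to a scalar. -/
theorem cone_affinographic_eq_range {κ : G → K}
    (h : IsGainRealization (coneBase K V) (coneDartForm κ)) (Γ : SimpleGainGraph V G) :
    cone (affinographic κ Γ) =
      Set.range fun s => LinearMap.ker (gainForms (coneBase K V) (coneDartForm κ) Γ s) := by
  classical
  have dart : ∀ (i j : V) (g : G) (hij : i ≠ j),
      LinearMap.ker (coneDartForm κ ⟨i, j, g, hij⟩) = LinearMap.ker
        (coneDartForm κ (Quotient.out (s := gainSetoid V G) (GainEdge.mk i j g hij))) :=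
    fun i j g hij => (h.proportional_out ⟨i, j, g, hij⟩).ker_eq.symm
  ext H
  constructor
  · rintro (rfl | ⟨α, c, hα, ⟨i, j, g, hij, he, hset⟩, rfl⟩)
    · exact ⟨Sum.inl (), rfl⟩
    · refine ⟨Sum.inr ⟨_, he⟩, (dart i j g hij).symm.trans ?_⟩
      have hmem : ∀ x : V → K, α x = c ↔ x i - x j = κ g := fun x => Set.ext_iff.1 hset x
      -- a point of the hyperplane
      have hx₀ : α (Pi.single i (κ g)) = c := (hmem _).2 (by simp [hij.symm])
      obtain ⟨t, ht⟩ := exists_eq_smul_of_ker_le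
        (α := (LinearMap.proj i : (V → K) →ₗ[K] K) - LinearMap.proj j) (β := α) (by
          intro v hv
          rw [LinearMap.mem_ker, LinearMap.sub_apply, LinearMap.proj_apply,
            LinearMap.proj_apply] at hv
          have := (hmem (Pi.single i (κ g) + v)).2 (by
            simp only [Pi.add_apply, Pi.single_eq_same, Pi.single_eq_of_ne hij.symm]
            linear_combination hv)
          rw [map_add, hx₀] at this
          rw [LinearMap.mem_ker]
          linear_combination this)
      have ht0 : t ≠ 0 := by
        rintro rfl
        exact hα (by rw [ht, zero_smul])
      have hc : c = t * κ g := by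
        rw [← hx₀, ht]
        simp [hij.symm]
      refine (Proportional.ker_eq ⟨t, ht0, LinearMap.ext fun x => ?_⟩).symm
      rw [ht, hc]
      simp only [LinearMap.sub_apply, LinearMap.comp_apply, LinearMap.smul_apply, smul_eq_mul,
        LinearMap.proj_apply, LinearMap.funLeft_apply, coneDartForm_apply]
      ring
  · rintro ⟨s | ⟨e, he⟩, rfl⟩
    · exact Or.inl rfl
    · induction e using Quotient.inductionOn with | _ a => ?_
      obtain ⟨i, j, g, hij⟩ := a
      refine Or.inr ⟨(LinearMap.proj i : (V → K) →ₗ[K] K) - LinearMap.proj j, κ g, ?_, ⟨i, j, g, hij, he, rfl⟩, ?_⟩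
      · intro h0
        have := LinearMap.congr_fun h0 (Pi.single i 1)
        simp [hij.symm] at this
      · exact (dart i j g hij).symm

/-- The coefficients of the `x`-coordinates recover the endpoints and the scalar; that of `z` then
recovers `κ g`, hence the gain by injectivity. -/
theorem isGainRealization_cone {κ : G → K} (hadd : ∀ g h, κ (g + h) = κ g + κ h)
    (hinj : Function.Injective κ) : IsGainRealization (coneBase K V) (coneDartForm κ) := by
  classical
  have hzero : κ 0 = 0 := by simpa using hadd 0 0
  have hneg : ∀ g, κ (-g) = -κ g := fun g => by
    have := hadd (-g) g
    rw [neg_add_cancel, hzero] at this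
    linear_combination -this
  have hfst : ∀ a : GainDart V G, coneDartForm κ a (Pi.single (some a.fst) 1) = 1 := fun a => by
    simp [coneDartForm_apply, a.ne.symm]
  have hbase : ∀ s, coneBase K V s ≠ 0 := fun s h0 => by
    have := LinearMap.congr_fun h0 (Pi.single none 1)
    simp [coneBase] at this
  refine ⟨⟨hbase, fun s t hst => absurd rfl hst⟩, ?_, ?_, ?_, ?_⟩
  · intro a h0
    have := hfst a
    rw [h0] at this
    exact zero_ne_one this
  · intro a
    refine ⟨-1, neg_ne_zero.2 one_ne_zero, LinearMap.ext fun x => ?_⟩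
    simp only [LinearMap.smul_apply, coneDartForm_apply, GainDart.rev, hneg, smul_eq_mul]
    ring
  · intro a b c hab
    have hx := fun x => LinearMap.congr_fun hab x
    simp only [LinearMap.smul_apply, coneDartForm_apply, smul_eq_mul] at hx
    have h1 := hx (Pi.single (some a.fst) 1)
    have h2 := hx (Pi.single (some a.snd) 1)
    have h3 := hx (Pi.single none 1)
    obtain ⟨i, j, g, hij⟩ := a
    obtain ⟨k, l, h, hkl⟩ := b
    simp only [Pi.single_apply, Option.some.injEq, reduceCtorEq, if_true, if_false, mul_zero,
      mul_one, sub_zero, hij, hij.symm, zero_sub] at h1 h2 h3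
    by_cases hik : k = i
    · subst hik
      simp only [if_true, hkl.symm, if_false, sub_zero, mul_one, hij] at h1 h2
      by_cases hjl : l = j
      · subst hjl
        rw [← h1, one_mul, neg_inj] at h3
        rw [hinj h3]
        exact Or.inl rfl
      · simp [hjl] at h2
    · by_cases hil : l = i
      · subst hil
        simp only [if_true, hkl, if_false, zero_sub, mul_neg, mul_one, hij] at h1 h2
        by_cases hjk : k = j
        · subst hjk
          right
          have : κ g = κ (-h) := by rw [hneg]; linear_combination -h3 + κ h * h1
          rw [hinj this]
          rfl
        · simp [hjk] at h2
      · simp [hik, hil] at h1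
  · intro s a c h0
    have h1 := LinearMap.congr_fun h0 (Pi.single (some a.fst) 1)
    rw [LinearMap.smul_apply, hfst] at h1
    have hc : c = 0 := by simpa [coneBase] using h1.symm
    rw [hc, zero_smul] at h0
    exact hbase s h0

variable [DecidableEq V]

/-- The parametrization of the hyperplane `x_i = x_j + c z` by the other coordinates. -/
noncomputable def coneParam {i j : V} (hij : i ≠ j) (c : K) :
    (Option {w : V // w ≠ i} → K) →ₗ[K] (Option V → K) :=
  LinearMap.pi fun o => o.elim (LinearMap.proj none) fun w =>
    if hw : w = i then LinearMap.proj (some ⟨j, hij.symm⟩) + c • LinearMap.proj none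
    else LinearMap.proj (some ⟨w, hw⟩)

theorem coneParam_none {i j : V} (hij : i ≠ j) (c : K) (y : Option {w : V // w ≠ i} → K) :
    coneParam hij c y none = y none :=
  rfl

theorem coneParam_self {i j : V} (hij : i ≠ j) (c : K) (y : Option {w : V // w ≠ i} → K) :
    coneParam hij c y (some i) = y (some ⟨j, hij.symm⟩) + c * y none := by
  simp [coneParam]

theorem coneParam_of_ne {i j : V} (hij : i ≠ j) (c : K) (y : Option {w : V // w ≠ i} → K)
    {w : V} (hw : w ≠ i) : coneParam hij c y (some w) = y (some ⟨w, hw⟩) := by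
  simp [coneParam, hw]

theorem isHyperplaneParam_cone {κ : G → K}
    (h : IsGainRealization (coneBase K V) (coneDartForm κ)) {i j : V} (g : G) (hij : i ≠ j) :
    IsHyperplaneParam (coneParam hij (κ g))
      (LinearMap.funLeft K K (Option.map Subtype.val))
      (coneDartForm κ ⟨i, j, g, hij⟩) where
  ne_zero := h.ne_zero _
  comp_eq_zero := by
    refine LinearMap.ext fun y => ?_
    simp only [LinearMap.comp_apply, coneDartForm_apply, coneParam_none, coneParam_self,
      coneParam_of_ne hij _ _ hij.symm, LinearMap.zero_apply]
    ring
  left_inv := by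
    refine LinearMap.ext fun y => funext fun o => ?_
    rcases o with _ | w
    · rfl
    · exact coneParam_of_ne hij _ y w.2
  right_inv := by
    intro x hx
    rw [coneDartForm_apply] at hx
    funext o
    rcases o with _ | w
    · rfl
    · by_cases hw : w = i
      · subst hw
        rw [coneParam_self]
        simp only [LinearMap.funLeft_apply, Option.map_some, Option.map_none]
        linear_combination -hx
      · rw [coneParam_of_ne hij _ _ hw]
        rfl

/-- Substituting `x_i = x_j + κ(g) z` adds gains along moved edges, and turns a parallel edge `(j,
i, h)` into `-κ(h + g) z`, a nonzero multiple of `z`. -/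
theorem isContractionMap_cone {κ : G → K} (hadd : ∀ g h, κ (g + h) = κ g + κ h)
    (hinj : Function.Injective κ) {i j : V} (g : G) (hij : i ≠ j) :
    IsContractionMap (coneBase K V) (coneDartForm κ) (g := g) hij
      (coneBase K {w : V // w ≠ i}) (coneDartForm κ) (coneParam hij (κ g)) where
  base_map _ := ⟨(), 1, one_ne_zero, by rw [one_smul]; rfl⟩
  base_surj _ := ⟨(), 1, one_ne_zero, by rw [one_smul]; rfl⟩
  keep u v h huv := by
    refine ⟨1, one_ne_zero, LinearMap.ext fun y => ?_⟩
    simp only [LinearMap.comp_apply, one_smul, coneDartForm_apply, coneParam_none,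
      coneParam_of_ne hij _ y u.2, coneParam_of_ne hij _ y v.2]
  move k h hk := by
    refine ⟨1, one_ne_zero, LinearMap.ext fun y => ?_⟩
    simp only [LinearMap.comp_apply, one_smul, coneDartForm_apply, coneParam_none,
      coneParam_of_ne hij _ y k.2, coneParam_self, hadd]
    ring
  parallel h hne := by
    have hzero : κ 0 = 0 := by simpa using hadd 0 0
    refine ⟨(), -κ (h + g), neg_ne_zero.2 fun h0 => hne (hinj (h0.trans hzero.symm)),
      LinearMap.ext fun y => ?_⟩
    simp only [LinearMap.comp_apply, LinearMap.smul_apply, coneDartForm_apply, coneParam_none,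
      coneParam_of_ne hij _ y hij.symm, coneParam_self, hadd, coneBase, LinearMap.proj_apply,
      smul_eq_mul]
    ring

end Cone

/-! ### The bias arrangement -/

section Bias

variable {V : Type u} {G : Type v}

/-- The form `x_i`. -/
noncomputable def biasBase (V : Type u) : V → (V → ℂ) →ₗ[ℂ] ℂ :=
  fun i => LinearMap.proj i

/-- The form `x_i - χ(g) x_j`. -/
noncomputable def biasDartForm (χ : G → ℂ) (a : GainDart V G) : (V → ℂ) →ₗ[ℂ] ℂ :=
  (LinearMap.proj a.fst : (V → ℂ) →ₗ[ℂ] ℂ) - χ a.gain • LinearMap.proj a.snd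

theorem biasDartForm_apply (χ : G → ℂ) (a : GainDart V G) (x : V → ℂ) :
    biasDartForm χ a x = x a.fst - χ a.gain * x a.snd :=
  rfl

variable [AddGroup G]

theorem bias_eq_range {χ : G → ℂ} (h : IsGainRealization (biasBase V) (biasDartForm χ))
    (Γ : SimpleGainGraph V G) :
    bias χ Γ = Set.range fun s => LinearMap.ker (gainForms (biasBase V) (biasDartForm χ) Γ s) := by
  have dart : ∀ (i j : V) (g : G) (hij : i ≠ j),
      LinearMap.ker (biasDartForm χ ⟨i, j, g, hij⟩) = LinearMap.ker
        (biasDartForm χ (Quotient.out (s := gainSetoid V G) (GainEdge.mk i j g hij))) :=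
    fun i j g hij => (h.proportional_out ⟨i, j, g, hij⟩).ker_eq.symm
  ext H
  constructor
  · rintro (⟨i, rfl⟩ | ⟨i, j, g, hij, he, rfl⟩)
    · exact ⟨Sum.inl i, rfl⟩
    · exact ⟨Sum.inr ⟨_, he⟩, (dart i j g hij).symm⟩
  · rintro ⟨s | ⟨e, he⟩, rfl⟩
    · exact Or.inl ⟨s, rfl⟩
    · induction e using Quotient.inductionOn with | _ a => ?_
      obtain ⟨i, j, g, hij⟩ := a
      exact Or.inr ⟨i, j, g, hij, he, (dart i j g hij).symm⟩

theorem isGainRealization_bias {χ : G → ℂ} (hzero : χ 0 = 1)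
    (hadd : ∀ g h, χ (g + h) = χ g * χ h) (hinj : Function.Injective χ) :
    IsGainRealization (biasBase V) (biasDartForm χ) := by
  classical
  have hneg : ∀ g, χ (-g) * χ g = 1 := fun g => by rw [← hadd, neg_add_cancel, hzero]
  have hne : ∀ g, χ g ≠ 0 := fun g => right_ne_zero_of_mul_eq_one (hneg g)
  have hfst : ∀ a : GainDart V G, biasDartForm χ a (Pi.single a.fst 1) = 1 := fun a => by
    simp [biasDartForm_apply, a.ne.symm]
  have hbase : ∀ s, biasBase V s (Pi.single s 1) = 1 := fun s => by simp [biasBase]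
  refine ⟨⟨?_, ?_⟩, ?_, ?_, ?_, ?_⟩
  · intro s h0
    have := hbase s
    rw [h0] at this
    exact zero_ne_one this
  · intro s t hst c h0
    have h1 := LinearMap.congr_fun h0 (Pi.single s 1)
    rw [hbase] at h1
    simp [biasBase, hst.symm] at h1
  · intro a h0
    have := hfst a
    rw [h0] at this
    exact zero_ne_one this
  · intro a
    refine ⟨-χ (-a.gain), neg_ne_zero.2 (hne _), LinearMap.ext fun x => ?_⟩
    simp only [LinearMap.smul_apply, biasDartForm_apply, GainDart.rev, smul_eq_mul]
    linear_combination -x a.snd * hneg a.gain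
  · intro a b c hab
    have hx := fun x => LinearMap.congr_fun hab x
    simp only [LinearMap.smul_apply, biasDartForm_apply, smul_eq_mul] at hx
    have h1 := hx (Pi.single a.fst 1)
    have h2 := hx (Pi.single a.snd 1)
    obtain ⟨i, j, g, hij⟩ := a
    obtain ⟨k, l, h, hkl⟩ := b
    simp only [Pi.single_apply, if_true, if_false, mul_zero, mul_one, sub_zero, hij, hij.symm,
      zero_sub] at h1 h2
    have hg := hne g
    by_cases hik : k = i
    · subst hik
      simp only [if_true, hkl.symm, if_false, sub_zero, mul_one, mul_zero, zero_sub, hij] at h1 h2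
      by_cases hjl : l = j
      · subst hjl
        rw [← h1, one_mul, if_pos rfl, mul_one, neg_inj] at h2
        rw [hinj h2]
        exact Or.inl rfl
      · simp [hjl, hg] at h2
    · by_cases hil : l = i
      · subst hil
        simp only [if_true, hkl, if_false, zero_sub, mul_neg, mul_one, mul_zero, sub_zero, hij]
          at h1 h2
        by_cases hjk : k = j
        · subst hjk
          right
          rw [if_pos rfl, mul_one] at h2
          have : χ (g + h) = χ 0 := by
            rw [hadd, hzero]
            linear_combination -h1 - χ h * h2
          rw [eq_neg_of_add_eq_zero_left (hinj this)]
          rfl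
        · simp [hjk, hg] at h2
      · simp [hik, hil] at h1
  · intro s a c h0
    -- a point of the hyperplane of `a` on no coordinate hyperplane
    have h1 := LinearMap.congr_fun h0 (Function.update (fun _ => 1) a.fst (χ a.gain))
    rw [LinearMap.smul_apply, biasDartForm_apply, Function.update_self,
      Function.update_of_ne a.ne.symm, mul_one, sub_self, smul_zero] at h1
    by_cases hs : s = a.fst
    · subst hs
      simp [biasBase, hne] at h1
    · simp [biasBase, hs] at h1

variable [DecidableEq V]

/-- The parametrization of the hyperplane `x_i = c x_j` by the other coordinates. -/
noncomputable def biasParam {i j : V} (hij : i ≠ j) (c : ℂ) :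
    ({w : V // w ≠ i} → ℂ) →ₗ[ℂ] (V → ℂ) :=
  LinearMap.pi fun w =>
    if hw : w = i then c • LinearMap.proj ⟨j, hij.symm⟩ else LinearMap.proj ⟨w, hw⟩

theorem biasParam_self {i j : V} (hij : i ≠ j) (c : ℂ) (y : {w : V // w ≠ i} → ℂ) :
    biasParam hij c y i = c * y ⟨j, hij.symm⟩ := by
  simp [biasParam]

theorem biasParam_of_ne {i j : V} (hij : i ≠ j) (c : ℂ) (y : {w : V // w ≠ i} → ℂ)
    {w : V} (hw : w ≠ i) : biasParam hij c y w = y ⟨w, hw⟩ := by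
  simp [biasParam, hw]

theorem isHyperplaneParam_bias {χ : G → ℂ} (h : IsGainRealization (biasBase V) (biasDartForm χ))
    {i j : V} (g : G) (hij : i ≠ j) :
    IsHyperplaneParam (biasParam hij (χ g)) (LinearMap.funLeft ℂ ℂ Subtype.val)
      (biasDartForm χ ⟨i, j, g, hij⟩) where
  ne_zero := h.ne_zero _
  comp_eq_zero := by
    refine LinearMap.ext fun y => ?_
    simp only [LinearMap.comp_apply, biasDartForm_apply, biasParam_self,
      biasParam_of_ne hij _ _ hij.symm, LinearMap.zero_apply, sub_self]
  left_inv := LinearMap.ext fun y => funext fun w => biasParam_of_ne hij _ y w.2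
  right_inv := by
    intro x hx
    rw [biasDartForm_apply] at hx
    funext w
    by_cases hw : w = i
    · subst hw
      rw [biasParam_self]
      exact (sub_eq_zero.1 hx).symm
    · rw [biasParam_of_ne hij _ _ hw]
      rfl

/-- Substituting `x_i = χ(g) x_j` multiplies the values of `χ`, and turns a parallel edge `(j, i,
h)` into `(1 - χ(h + g)) x_j`. The hyperplanes of `x_i` and `x_j` merge, so one coordinate
hyperplane is lost. -/
theorem isContractionMap_bias {χ : G → ℂ} (hzero : χ 0 = 1)
    (hadd : ∀ g h, χ (g + h) = χ g * χ h) (hinj : Function.Injective χ) {i j : V} (g : G)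
    (hij : i ≠ j) :
    IsContractionMap (biasBase V) (biasDartForm χ) (g := g) hij
      (biasBase {w : V // w ≠ i}) (biasDartForm χ) (biasParam hij (χ g)) where
  base_map s := by
    by_cases hs : s = i
    · subst hs
      have hne : χ g ≠ 0 := by
        refine right_ne_zero_of_mul_eq_one (a := χ (-g)) ?_
        rw [← hadd, neg_add_cancel, hzero]
      exact ⟨⟨j, hij.symm⟩, χ g, hne, LinearMap.ext fun y => biasParam_self hij _ y⟩
    · refine ⟨⟨s, hs⟩, 1, one_ne_zero, LinearMap.ext fun y => ?_⟩
      rw [one_smul]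
      exact biasParam_of_ne hij _ y hs
  base_surj t := by
    refine ⟨t, 1, one_ne_zero, LinearMap.ext fun y => ?_⟩
    rw [one_smul]
    exact biasParam_of_ne hij _ y t.2
  keep u v h huv := by
    refine ⟨1, one_ne_zero, LinearMap.ext fun y => ?_⟩
    simp only [LinearMap.comp_apply, one_smul, biasDartForm_apply,
      biasParam_of_ne hij _ y u.2, biasParam_of_ne hij _ y v.2]
  move k h hk := by
    refine ⟨1, one_ne_zero, LinearMap.ext fun y => ?_⟩
    simp only [LinearMap.comp_apply, one_smul, biasDartForm_apply,
      biasParam_of_ne hij _ y k.2, biasParam_self, hadd]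
    ring
  parallel h hne := by
    refine ⟨⟨j, hij.symm⟩, 1 - χ (h + g), ?_, LinearMap.ext fun y => ?_⟩
    · intro h0
      exact hne (hinj ((sub_eq_zero.1 h0).symm.trans hzero.symm))
    · simp only [LinearMap.comp_apply, LinearMap.smul_apply, biasDartForm_apply,
        biasParam_of_ne hij _ y hij.symm, biasParam_self, hadd, biasBase, LinearMap.proj_apply,
        smul_eq_mul]
      ring

end Bias

/-! ### Inductive freeness along edges in terms of exponents only -/

section NumericalFreeness

/-- The graphs that are reached from edgeless graphs by the rule of inductive freeness along edges,
where the exponents are replaced by the multiset `d` that the addition theorem predicts. It consists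
of the exponents of the cone without one exponent `1`, and of those of the bias arrangement
decreased by `1`. -/
inductive InductiveExponents {G : Type v} [AddGroup G] :
    ∀ {V : Type u} [Fintype V] [DecidableEq V], SimpleGainGraph V G → Multiset ℕ → Prop
  | of_isEmpty {V : Type u} [Fintype V] [DecidableEq V] (Γ : SimpleGainGraph V G)
      (h : Γ.edges = ∅) : InductiveExponents Γ (Multiset.replicate (Fintype.card V) 0)
  | of_edge {V : Type u} [Fintype V] [DecidableEq V] (Γ : SimpleGainGraph V G)
      (i j : V) (g : G) (hij : i ≠ j) (he : GainEdge.mk i j g hij ∈ Γ.edges)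
      (a : ℕ) (d : Multiset ℕ)
      (hdel : InductiveExponents (Γ.delete (GainEdge.mk i j g hij)) (a ::ₘ d))
      (hcon : InductiveExponents (Γ.contract i j g hij) d) :
      InductiveExponents Γ ((a + 1) ::ₘ d)

variable {G : Type v} [AddGroup G]

/-- For deletion and contraction together this says that `a` is the difference of their edge
numbers, the count that the addition theorem needs. -/
theorem InductiveExponents.sum_eq {V : Type u} [Fintype V] [DecidableEq V]
    {Γ : SimpleGainGraph V G} {d : Multiset ℕ} (h : InductiveExponents Γ d) :
    d.sum = Γ.edges.ncard := by
  induction h with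
  | of_isEmpty Γ h => simp [h]
  | of_edge Γ i j g hij he a d _ _ ih1 ih2 =>
    have h1 : (Γ.delete (GainEdge.mk i j g hij)).edges.ncard + 1 = Γ.edges.ncard :=
      Set.ncard_sdiff_singleton_add_one he Γ.finite_edges
    rw [Multiset.sum_cons] at ih1 ⊢
    omega

variable {K : Type*} [Field K]

theorem InductiveExponents.freeWithExponents_cone {κ : G → K}
    (hadd : ∀ g h, κ (g + h) = κ g + κ h) (hinj : Function.Injective κ)
    {V : Type u} [Fintype V] [DecidableEq V] {Γ : SimpleGainGraph V G} {d : Multiset ℕ}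
    (h : InductiveExponents Γ d) : FreeWithExponents (cone (affinographic κ Γ)) (1 ::ₘ d) := by
  change HasHomogeneousBasis _ _
  rw [logDer_eq_logDerForms (cone_affinographic_eq_range (isGainRealization_cone hadd hinj) Γ)]
  induction h with
  | @of_isEmpty V _ _ Γ h =>
    classical
    -- Without edges only `z = 0` remains: one exponent `1`, and a `0` for each vertex.
    convert hasHomogeneousBasis_of_coordinates (K := K) (fun o : Option V => o = none) ?_ using 1
    · rw [univ_option, Finset.insertNone]
      simp
    · intro η
      rw [mem_logDerForms]
      constructor
      · rintro hη _ rfl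
        have := hη (Sum.inl ())
        rwa [gainForms, Sum.elim_inl, coneBase, linearFormPoly_proj] at this
      · rintro hη (s | ⟨e, he⟩)
        · rw [gainForms, Sum.elim_inl, coneBase, linearFormPoly_proj]
          exact hη none rfl
        · rw [h] at he
          exact he.elim
  | of_edge Γ i j g hij he a d hdel hcon ih1 ih2 =>
    have h1 := hdel.sum_eq
    have h2 := hcon.sum_eq
    rw [Multiset.sum_cons] at h1
    rw [Multiset.cons_swap] at ih1 ⊢
    refine (isContractionMap_cone hadd hinj g hij).addition (isGainRealization_cone hadd hinj)
      (isGainRealization_cone hadd hinj)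
      (isHyperplaneParam_cone (isGainRealization_cone hadd hinj) g hij) Γ he ?_ ih1 ih2
    rw [Fintype.card_unit]
    omega

theorem InductiveExponents.freeWithExponents_bias {χ : G → ℂ} (hzero : χ 0 = 1)
    (hadd : ∀ g h, χ (g + h) = χ g * χ h) (hinj : Function.Injective χ)
    {V : Type u} [Fintype V] [DecidableEq V] {Γ : SimpleGainGraph V G} {d : Multiset ℕ}
    (h : InductiveExponents Γ d) : FreeWithExponents (bias χ Γ) (d.map (· + 1)) := by
  change HasHomogeneousBasis _ _
  rw [logDer_eq_logDerForms (bias_eq_range (isGainRealization_bias hzero hadd hinj) Γ)]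
  induction h with
  | @of_isEmpty V _ _ Γ h =>
    classical
    convert hasHomogeneousBasis_of_coordinates (K := ℂ) (fun _ : V => True) ?_ using 1
    · simp
    · intro η
      rw [mem_logDerForms]
      constructor
      · intro hη i _
        have := hη (Sum.inl i)
        rwa [gainForms, Sum.elim_inl, biasBase, linearFormPoly_proj] at this
      · rintro hη (s | ⟨e, he⟩)
        · rw [gainForms, Sum.elim_inl, biasBase, linearFormPoly_proj]
          exact hη s trivial
        · rw [h] at he
          exact he.elim
  | @of_edge V _ _ Γ i j g hij he a d hdel hcon ih1 ih2 =>
    have h1 := hdel.sum_eq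
    have h2 := hcon.sum_eq
    rw [Multiset.sum_cons] at h1
    rw [Multiset.map_cons] at ih1 ⊢
    refine (isContractionMap_bias hzero hadd hinj g hij).addition
      (isGainRealization_bias hzero hadd hinj) (isGainRealization_bias hzero hadd hinj)
      (isHyperplaneParam_bias (isGainRealization_bias hzero hadd hinj) g hij) Γ he ?_ ih1 ih2
    -- The lost coordinate hyperplane raises the difference of hyperplane numbers from `a` to `a +
    -- 1`, matching the shift of the exponents.
    have h3 : Fintype.card {w : V // w ≠ i} + 1 = Fintype.card V := by
      rw [Fintype.card_subtype_compl, Fintype.card_subtype_eq]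
      exact Nat.sub_add_cancel (Fintype.card_pos_iff.2 ⟨i⟩)
    omega

theorem InductiveExponents.card_eq {V : Type u} [Fintype V] [DecidableEq V]
    {Γ : SimpleGainGraph V G} {d : Multiset ℕ} (h : InductiveExponents Γ d) :
    Multiset.card d = Fintype.card V := by
  induction h with
  | of_isEmpty Γ h => simp
  | of_edge Γ i j g hij he a d _ _ ih1 _ => simpa using ih1

/-- The rule of inductive freeness along edges, with an inclusion of exponents. -/
theorem InductiveExponents.exists_of_le {V : Type u} [Fintype V] [DecidableEq V]
    {Γ : SimpleGainGraph V G} {i j : V} {g : G} {hij : i ≠ j}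
    (he : GainEdge.mk i j g hij ∈ Γ.edges) {d' d : Multiset ℕ}
    (hdel : InductiveExponents (Γ.delete (GainEdge.mk i j g hij)) d')
    (hcon : InductiveExponents (Γ.contract i j g hij) d) (hle : d ≤ d') :
    ∃ e, InductiveExponents Γ e := by
  obtain ⟨s, rfl⟩ := Multiset.le_iff_exists_add.1 hle
  have h1 := hdel.card_eq
  have h2 := hcon.card_eq
  have h3 : Fintype.card {w : V // w ≠ i} + 1 = Fintype.card V := by
    rw [Fintype.card_subtype_compl, Fintype.card_subtype_eq]
    exact Nat.sub_add_cancel (Fintype.card_pos_iff.2 ⟨i⟩)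
  have h4 : Multiset.card s = 1 := by
    rw [Multiset.card_add] at h1
    omega
  obtain ⟨a, rfl⟩ := Multiset.card_eq_one.1 h4
  rw [add_comm, Multiset.singleton_add] at hdel
  exact ⟨_, .of_edge Γ i j g hij he a d hdel hcon⟩

/-- Uniqueness replaces the given exponents by the predicted ones, and the common exponent `1`
cancels from the inclusion. In the other direction the inclusion is built into `a ::ₘ d`. -/
theorem coneInductivelyFreeAlongEdges_iff {κ : G → K}
    (hadd : ∀ g h, κ (g + h) = κ g + κ h) (hinj : Function.Injective κ)
    {V : Type u} [Fintype V] [DecidableEq V] (Γ : SimpleGainGraph V G) :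
    ConeInductivelyFreeAlongEdges κ Γ ↔ ∃ d, InductiveExponents Γ d := by
  constructor
  · intro h
    induction h with
    | of_isEmpty Γ h => exact ⟨_, .of_isEmpty Γ h⟩
    | of_edge Γ i j g hij he _ _ d' d'' hd' hd'' hle ih1 ih2 =>
      obtain ⟨e', h1⟩ := ih1
      obtain ⟨e, h2⟩ := ih2
      refine h1.exists_of_le he h2 ?_
      rwa [HasHomogeneousBasis.unique hd' (h1.freeWithExponents_cone hadd hinj),
        HasHomogeneousBasis.unique hd'' (h2.freeWithExponents_cone hadd hinj),
        Multiset.cons_le_cons_iff] at hle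
  · rintro ⟨d, h⟩
    induction h with
    | of_isEmpty Γ h => exact .of_isEmpty Γ h
    | of_edge Γ i j g hij he a d hdel hcon ih1 ih2 =>
      exact .of_edge Γ i j g hij he ih1 ih2 _ _ (hdel.freeWithExponents_cone hadd hinj)
        (hcon.freeWithExponents_cone hadd hinj)
        (Multiset.cons_le_cons _ (Multiset.le_cons_self _ _))

theorem biasInductivelyFreeAlongEdges_iff {χ : G → ℂ} (hzero : χ 0 = 1)
    (hadd : ∀ g h, χ (g + h) = χ g * χ h) (hinj : Function.Injective χ)
    {V : Type u} [Fintype V] [DecidableEq V] (Γ : SimpleGainGraph V G) :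
    BiasInductivelyFreeAlongEdges χ Γ ↔ ∃ d, InductiveExponents Γ d := by
  constructor
  · intro h
    induction h with
    | of_isEmpty Γ h => exact ⟨_, .of_isEmpty Γ h⟩
    | of_edge Γ i j g hij he _ _ d' d'' hd' hd'' hle ih1 ih2 =>
      obtain ⟨e', h1⟩ := ih1
      obtain ⟨e, h2⟩ := ih2
      refine h1.exists_of_le he h2 ?_
      rwa [HasHomogeneousBasis.unique hd' (h1.freeWithExponents_bias hzero hadd hinj),
        HasHomogeneousBasis.unique hd'' (h2.freeWithExponents_bias hzero hadd hinj),
        Multiset.map_le_map_iff (add_left_injective 1)] at hle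
  · rintro ⟨d, h⟩
    induction h with
    | of_isEmpty Γ h => exact .of_isEmpty Γ h
    | of_edge Γ i j g hij he a d hdel hcon ih1 ih2 =>
      exact .of_edge Γ i j g hij he ih1 ih2 _ _ (hdel.freeWithExponents_bias hzero hadd hinj)
        (hcon.freeWithExponents_bias hzero hadd hinj)
        (Multiset.map_le_map (Multiset.le_cons_self _ _))

end NumericalFreeness

/-! ### The gain groups `ℤ` and `ZMod p` -/

theorem zpow_injective_of_pow_ne_one {q : ℂ} (hq : q ≠ 0) (h : ∀ n : ℕ, 0 < n → q ^ n ≠ 1) :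
    Function.Injective fun g : ℤ => q ^ g := by
  have key : ∀ m n : ℤ, m < n → q ^ m ≠ q ^ n := by
    intro m n hmn heq
    refine h (n - m).toNat (by omega) ?_
    rw [← zpow_natCast, Int.toNat_of_nonneg (by omega), zpow_sub₀ hq, ← heq,
      div_self (zpow_ne_zero _ hq)]
  intro m n heq
  rcases lt_trichotomy m n with hmn | hmn | hmn
  · exact (key m n hmn heq).elim
  · exact hmn
  · exact (key n m hmn heq.symm).elim

theorem theorem1p4 {V : Type u} [Fintype V] [DecidableEq V] :
    (∀ (Γ : SimpleGainGraph V ℤ) (q : ℂ), q ≠ 0 → (∀ n : ℕ, 0 < n → q ^ n ≠ 1) →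
      (ConeInductivelyFreeAlongEdges (fun g : ℤ => (g : ℚ)) Γ ↔
        BiasInductivelyFreeAlongEdges (fun g : ℤ => q ^ g) Γ)) ∧
    (∀ (p : ℕ) [Fact p.Prime] (Γ : SimpleGainGraph V (ZMod p)) (q : ℂ), IsPrimitiveRoot q p →
      (ConeInductivelyFreeAlongEdges (fun g : ZMod p => g) Γ ↔
        BiasInductivelyFreeAlongEdges (fun g : ZMod p => q ^ g.val) Γ)) := by
  constructor
  · intro Γ q hq h
    rw [coneInductivelyFreeAlongEdges_iff (fun _ _ => Int.cast_add _ _) Int.cast_injective,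
      biasInductivelyFreeAlongEdges_iff (zpow_zero q) (fun _ _ => zpow_add₀ hq _ _)
        (zpow_injective_of_pow_ne_one hq h)]
  · intro p _ Γ q hq
    rw [coneInductivelyFreeAlongEdges_iff (κ := fun g : ZMod p => g) (fun _ _ => rfl)
        fun _ _ h => h,
      biasInductivelyFreeAlongEdges_iff (by simp) (fun g h => ?_) (fun g h hgh => ?_)]
    -- Representatives add only modulo `p`, which is the order of `q`.
    · rw [ZMod.val_add, ← pow_add]
      generalize g.val + h.val = n
      rw [hq.eq_orderOf, pow_mod_orderOf]
    · exact ZMod.val_injective p (hq.pow_inj (ZMod.val_lt g) (ZMod.val_lt h) hgh)
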